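/- Let $G$ be a finite subgroup of $\mathrm{SL}(2,\mathbb{C})$ and let $R=\mathbb{C}[u]$ be the polynomial ring in one variable. Let $G$ act on the free algebra $R\langle x,y\rangle$ by $R$-algebra automorphisms through its natural linear action on the coordinate functions $x,y$ of $\mathbb{C}^2$ (trivially on $R$), and let $R\langle x,y\rangle \# G$ be the skew group algebra. Let $\tau$ be an element of the centre $Z(RG)$ of the group algebra $RG$, and put $$A^{\tau}=(R\langle x,y\rangle \# G)/(xy-yx-\tau),$$ the quotient by the two-sided ideal generated by $xy-yx-\tau$. Let $e=|G|^{-1}\sum_{g\in G} g\in A^{\tau}$ be the averaging idempotent, let $C^{\tau}=eA^{\tau}e$ (a ring with identity $e$, not commutative in general), and regard the left ideal $A^{\tau}e$ as a right $C^{\tau}$-module by multiplication in $A^{\tau}$. Then $A^{\tau}e$ is a finitely generated reflexive right $C^{\tau}$-module, that is, it is finitely generated and the natural evaluation map $$A^{\tau}e\longrightarrow \mathrm{Hom}_{C^{\tau}}\big(\mathrm{Hom}_{C^{\tau}}(A^{\tau}e,C^{\tau}),C^{\tau}\big)$$ is an isomorphism, where the inner $\mathrm{Hom}$ is of right $C^{\tau}$-modules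 and the outer one of left $C^{\tau}$-modules. Moreover $A^{\tau}\cong \mathrm{End}_{C^{\tau}}(A^{\tau}e)$ as rings, the isomorphism sending $a\in A^{\tau}$ to left multiplication by $a$ on $A^{\tau}e$. -/

import Mathlib

noncomputable section

namespace CBH

open Polynomial MulOpposite

/-! ### Right modules: natural maps -/

section RightModules

variable (C M : Type*) [Ring C] [AddCommGroup M] [Module Cᵐᵒᵖ M]

/-- The natural map `M → Hom_C(Hom_C(M, C), C)`, `m ↦ (f ↦ f m)`, for a right module `M` over a
(not necessarily commutative) ring `C`. Right `C`-modules are modules over `Cᵐᵒᵖ`; the dual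
`M →ₗ[Cᵐᵒᵖ] C` of the right module `M` is the left `C`-module with `(c • f) m = c * f m`, and the
dual of that left module is again a right `C`-module, with `(φ • c) f = φ f * c`. -/
def bidualMap : M →ₗ[Cᵐᵒᵖ] ((M →ₗ[Cᵐᵒᵖ] C) →ₗ[C] C) where
  toFun m :=
    { toFun := fun f => f m
      map_add' := fun _ _ => rfl
      map_smul' := fun _ _ => rfl }
  map_add' m n := by ext f; exact map_add f m n
  map_smul' c m := by ext f; exact map_smul f c m

/-- A right `C`-module is reflexive if the natural map to its bidual is an isomorphism. -/
def IsReflexiveRight : Prop := Function.Bijective (bidualMap C M)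

end RightModules

/-! ### The right `eAe`-module `Ae` -/

section Peirce

variable {A : Type*} [Ring A] {e : A}

lemma mul_idem_of_mem (he : IsIdempotentElem e) {a : A} (ha : a ∈ Ideal.span {e}) :
    a * e = a := by
  obtain ⟨b, rfl⟩ := Ideal.mem_span_singleton'.1 ha
  rw [mul_assoc, he.eq]

lemma mul_corner_mem (he : IsIdempotentElem e) (a : A) (c : he.Corner) :
    a * c.1 ∈ Ideal.span {e} := by
  refine Ideal.mem_span_singleton'.2 ⟨a * c.1, ?_⟩
  rw [mul_assoc, ((Subsemigroup.mem_corner_iff he).1 c.2).2]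

/-- For an idempotent `e` of a ring `A`, the left ideal `Ae` is a right module over the corner ring
`eAe` by multiplication in `A`. -/
instance peirceRightModule (he : IsIdempotentElem e) :
    Module he.Cornerᵐᵒᵖ (Ideal.span {e} : Ideal A) where
  smul c m := ⟨m.1 * (unop c).1, mul_corner_mem he m.1 (unop c)⟩
  one_smul m := Subtype.ext (mul_idem_of_mem he m.2)
  mul_smul c d m := Subtype.ext (mul_assoc m.1 (unop d).1 (unop c).1).symm
  smul_zero c := Subtype.ext (zero_mul (unop c).1)
  smul_add c m n := Subtype.ext (add_mul m.1 n.1 (unop c).1)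
  add_smul c d m := Subtype.ext (mul_add m.1 (unop c).1 (unop d).1)
  zero_smul m := Subtype.ext (mul_zero m.1)

end Peirce

/-! ### The action of `SL(2, ℂ)` on `ℂ[u]⟨x, y⟩` -/

/-- `R⟨x, y⟩` with `R = ℂ[u]`: the free (noncommutative) `R`-algebra on `x` (the generator with
index `0`) and `y` (index `1`). -/
abbrev FreeXY : Type := FreeAlgebra ℂ[X] (Fin 2)

instance : Ring FreeXY := inferInstance

/-- The `ℂ[u]`-algebra endomorphism of `ℂ[u]⟨x, y⟩` given by `g`, where `x`, `y` are viewed as the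
coordinate functions on `ℂ²`: the function `x_i` is sent to `v ↦ x_i (g⁻¹ v)`, that is, to
`∑ j, (g⁻¹)_{ij} x_j`. -/
def substHom (g : Matrix.SpecialLinearGroup (Fin 2) ℂ) : FreeXY →ₐ[ℂ[X]] FreeXY :=
  FreeAlgebra.lift ℂ[X] fun i =>
    ∑ j, Polynomial.C ((g⁻¹).1 i j) • FreeAlgebra.ι ℂ[X] j

lemma substHom_ι (g : Matrix.SpecialLinearGroup (Fin 2) ℂ) (i : Fin 2) :
    substHom g (FreeAlgebra.ι ℂ[X] i) =
      ∑ j, Polynomial.C ((g⁻¹).1 i j) • FreeAlgebra.ι ℂ[X] j :=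
  FreeAlgebra.lift_ι_apply _ _

/-- The natural action of `SL(2, ℂ)` on `ℂ[u]⟨x, y⟩` as a monoid homomorphism. -/
def actionHom : Matrix.SpecialLinearGroup (Fin 2) ℂ →* (FreeXY →ₐ[ℂ[X]] FreeXY) where
  toFun := substHom
  map_one' := by
    apply FreeAlgebra.hom_ext
    funext i
    fin_cases i <;> simp [substHom_ι]
  map_mul' g h := by
    apply FreeAlgebra.hom_ext
    funext i
    simp only [Function.comp_apply, substHom_ι, AlgHom.mul_apply, map_smul, mul_inv_rev,
      Matrix.SpecialLinearGroup.coe_mul, Matrix.mul_apply, Fin.sum_univ_two, map_add, map_mul]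
    module

/-- The natural action of `SL(2, ℂ)` (hence of each of its subgroups) on `ℂ[u]⟨x, y⟩` by ring
automorphisms, trivial on `ℂ[u]`. -/
instance : MulSemiringAction (Matrix.SpecialLinearGroup (Fin 2) ℂ) FreeXY where
  smul g p := actionHom g p
  one_smul p := by change actionHom 1 p = p; rw [map_one]; rfl
  mul_smul g h p := by
    change actionHom (g * h) p = actionHom g (actionHom h p); rw [map_mul]; rfl
  smul_zero g := map_zero (actionHom g)
  smul_add g := map_add (actionHom g)
  smul_one g := map_one (actionHom g)
  smul_mul g := map_mul (actionHom g)

instance : SMulCommClass (Matrix.SpecialLinearGroup (Fin 2) ℂ) ℂ[X] FreeXY where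
  smul_comm g r p := map_smul (actionHom g) r p

/-! ### The algebras `A^τ` and `C^τ` -/

variable (G : Subgroup (Matrix.SpecialLinearGroup (Fin 2) ℂ))

/-- The skew group algebra `R⟨x, y⟩ # G`, `R = ℂ[u]`, with multiplication
`(p g) (q h) = p (g • q) (g h)`. -/
abbrev SkewXY : Type := SkewMonoidAlgebra FreeXY G

instance : Ring (SkewXY G) := inferInstance

/-- The inclusion of the group algebra `RG` in `R⟨x, y⟩ # G`. -/
def groupAlgebraIncl : MonoidAlgebra ℂ[X] G →ₐ[ℂ[X]] SkewXY G :=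
  MonoidAlgebra.lift ℂ[X] (SkewXY G) G (SkewMonoidAlgebra.of FreeXY G)

/-- The element `p` of `R⟨x, y⟩`, seen in `R⟨x, y⟩ # G`. -/
def poly (p : FreeXY) : SkewXY G := SkewMonoidAlgebra.single 1 p

variable {G}

/-- The relation `xy - yx - τ = 0` on `R⟨x, y⟩ # G`. -/
def relA (τ : MonoidAlgebra ℂ[X] G) (a b : SkewXY G) : Prop :=
  a = poly G (FreeAlgebra.ι ℂ[X] 0 * FreeAlgebra.ι ℂ[X] 1
        - FreeAlgebra.ι ℂ[X] 1 * FreeAlgebra.ι ℂ[X] 0) - groupAlgebraIncl G τ ∧ b = 0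

/-- The algebra `A^τ = (R⟨x, y⟩ # G) / (xy - yx - τ)`: the quotient by the two-sided ideal generated
by `xy - yx - τ`, for `τ` in the group algebra `RG`. -/
def AlgA (τ : MonoidAlgebra ℂ[X] G) : Type := RingQuot (relA τ)

instance (τ : MonoidAlgebra ℂ[X] G) : Ring (AlgA τ) :=
  inferInstanceAs (Ring (RingQuot (relA τ)))

instance (τ : MonoidAlgebra ℂ[X] G) : Algebra ℂ[X] (AlgA τ) :=
  inferInstanceAs (Algebra ℂ[X] (RingQuot (relA τ)))

/-- The quotient map `R⟨x, y⟩ # G → A^τ`. -/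
def mkA (τ : MonoidAlgebra ℂ[X] G) : SkewXY G →ₐ[ℂ[X]] AlgA τ :=
  RingQuot.mkAlgHom ℂ[X] (relA τ)

/-- The natural homomorphism `RG → A^τ`. -/
def groupAlgebraToA (τ : MonoidAlgebra ℂ[X] G) : MonoidAlgebra ℂ[X] G →ₐ[ℂ[X]] AlgA τ :=
  (mkA τ).comp (groupAlgebraIncl G)

variable (G) in
/-- The averaging element `|G|⁻¹ ∑ g` of the group algebra `RG`. -/
def averaging [Fintype G] : MonoidAlgebra ℂ[X] G :=
  Polynomial.C ((Fintype.card G : ℂ)⁻¹) • ∑ g : G, MonoidAlgebra.of ℂ[X] G g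

lemma averaging_idem [Fintype G] : IsIdempotentElem (averaging G) := by
  have h (g : G) : MonoidAlgebra.of ℂ[X] G g * ∑ h : G, MonoidAlgebra.of ℂ[X] G h
      = ∑ h : G, MonoidAlgebra.of ℂ[X] G h := by
    rw [Finset.mul_sum]
    simp_rw [← map_mul]
    exact Function.Bijective.sum_comp (Group.mulLeft_bijective g) _
  have hc : (Fintype.card G : ℂ) ≠ 0 := Nat.cast_ne_zero.2 Fintype.card_ne_zero
  unfold IsIdempotentElem averaging
  rw [smul_mul_smul_comm, Finset.sum_mul, Finset.sum_congr rfl fun g _ => h g, Finset.sum_const,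
    Finset.card_univ, ← Nat.cast_smul_eq_nsmul ℂ[X], smul_smul, ← Polynomial.C_eq_natCast,
    ← Polynomial.C_mul, ← Polynomial.C_mul, mul_assoc, inv_mul_cancel₀ hc, mul_one]

/-- The averaging idempotent `e = |G|⁻¹ ∑ g` in `A^τ`. -/
def idemE [Fintype G] (τ : MonoidAlgebra ℂ[X] G) : AlgA τ := groupAlgebraToA τ (averaging G)

lemma idemE_idem [Fintype G] (τ : MonoidAlgebra ℂ[X] G) : IsIdempotentElem (idemE τ) :=
  averaging_idem.map (groupAlgebraToA τ)

/-- The ring `C^τ = e A^τ e`, with identity element `e`. -/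
abbrev AlgC [Fintype G] (τ : MonoidAlgebra ℂ[X] G) : Type := (idemE_idem τ).Corner

/-- The left ideal `A^τ e`, a right `C^τ`-module by multiplication in `A^τ`. -/
abbrev ModAe [Fintype G] (τ : MonoidAlgebra ℂ[X] G) : Ideal (AlgA τ) := Ideal.span {idemE τ}

end CBH

end

/-! Write `A` for `A^τ` and `R` for `ℂ[u]`. Filter `A` by degree in `x` and `y`, with `R` and `G` in
degree zero. The ordered monomials `x^i y^j g` form an `R`-basis of `A`, so at the level of symbols
`A` looks like `R[x,y] # G`, whatever the central element `τ` is.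

The key point is that the trace ideal `AeA` is large. It contains elements `p`, `q` with symbols
`x^N`, `y^N`, where `N = |G| - 1` (`exists_mem_traceIdeal`). These symbols form a regular sequence
from either side, and this depth-two property forces every right `A`-linear map `AeA → A` to be left
multiplication by an element of `A`, and symmetrically on the left (`exists_eq_mul_left`,
`exists_eq_mul_right`). The multiplier is found by successive approximation: regularity produces the
leading part of the multiplier, and subtracting it lowers the degree of the map.

The three claims follow formally. An `eAe`-linear map `φ : Ae → A` extends to `AeA` by `a e b ↦
φ(ae) b`, hence is a left multiplication (`exists_mul_left_of_linear`). This gives `End(Ae) = A` and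
`Hom(Ae, eAe) = eA`; the mirror statement identifies the dual of `eA` with `Ae`, which is
reflexivity. Moreover `AeA` is a finitely generated right ideal, and expanding its generators as
sums of `a e b` yields finitely many `ae` generating `Ae` over `eAe`.

Two inputs remain. Independence of the ordered monomials is proved by letting `A` act on the free
module they should span. The action of `y` is defined by recursion on degree, and the relations are
checked by induction on degree (`pbwG_low`), using that `τ` is central and that `G` has determinant
one. The elements `p`, `q` are obtained from `∑ g`, a multiple of `e`, by twisted commutators with
linear forms, each removing one group element at the cost of one degree
(`exists_mem_traceIdeal_of_finset`). This works because a nontrivial element of a finite subgroup of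
`SL(2, ℂ)` does not have eigenvalue one. -/

noncomputable section

namespace CBH

open Polynomial MulOpposite

/-! ### Linear maps out of an ideal containing a regular pair -/

section FilteredPair

variable {R A : Type*} [CommRing R] [Ring A] [Algebra R A]

/-- A `ℤ`-indexed exhaustive filtration of an `R`-algebra `A` by finitely generated `R`-submodules,
vanishing in negative degrees, with two elements `p`, `q` of degree `N` whose symbols commute and
behave like the regular sequence `x ^ N`, `y ^ N` in a polynomial ring in two variables, from the
left and from the right. -/
structure IsFilteredPair (F : ℤ → Submodule R A) (p q : A) (N : ℤ) : Prop where
  mono : Monotone F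
  mul_mem : ∀ {m n a b}, a ∈ F m → b ∈ F n → a * b ∈ F (m + n)
  eq_bot : ∀ n, n < 0 → F n = ⊥
  exists_mem : ∀ a, ∃ n, a ∈ F n
  fg : ∀ n, (F n).FG
  nonneg : 0 ≤ N
  left_mem : p ∈ F N
  right_mem : q ∈ F N
  comm_mem : p * q - q * p ∈ F (2 * N - 1)
  mem_of_mul_right : ∀ a n, a * p ∈ F (n + N) → a ∈ F n
  mem_of_mul_left : ∀ a n, p * a ∈ F (n + N) → a ∈ F n
  div_right : ∀ a b n, a ∈ F n → b ∈ F n → a * q - b * p ∈ F (n + N - 1) →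
    ∃ m ∈ F (n - N), a - m * p ∈ F (n - 1) ∧ b - m * q ∈ F (n - 1)
  div_left : ∀ a b n, a ∈ F n → b ∈ F n → q * a - p * b ∈ F (n + N - 1) →
    ∃ m ∈ F (n - N), a - p * m ∈ F (n - 1) ∧ b - q * m ∈ F (n - 1)
  decomp_left : ∀ s n, 2 * N - 1 ≤ n → s ∈ F n →
    ∃ c ∈ F (n - N), ∃ c' ∈ F (n - N), s - (p * c + q * c') ∈ F (n - 1)
  decomp_right : ∀ s n, 2 * N - 1 ≤ n → s ∈ F n →
    ∃ c ∈ F (n - N), ∃ c' ∈ F (n - N), s - (c * p + c' * q) ∈ F (n - 1)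

namespace IsFilteredPair

variable {F : ℤ → Submodule R A} {p q : A} {N : ℤ} (h : IsFilteredPair F p q N)
include h

lemma mul_mem' {m n k : ℤ} {a b : A} (ha : a ∈ F m) (hb : b ∈ F n) (hk : m + n ≤ k) :
    a * b ∈ F k :=
  h.mono hk (h.mul_mem ha hb)

lemma eq_zero_of_neg {a : A} {n : ℤ} (hn : n < 0) (ha : a ∈ F n) : a = 0 := by
  rw [h.eq_bot n hn] at ha; simpa using ha

lemma eq_zero_of_mul_right {a : A} (ha : a * p = 0) : a = 0 := by
  refine h.eq_zero_of_neg (n := -1) (by norm_num) (h.mem_of_mul_right _ _ ?_)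
  rw [ha]; exact zero_mem _

lemma eq_zero_of_mul_left {a : A} (ha : p * a = 0) : a = 0 := by
  refine h.eq_zero_of_neg (n := -1) (by norm_num) (h.mem_of_mul_left _ _ ?_)
  rw [ha]; exact zero_mem _

/-- The opposite filtration. -/
lemma op : IsFilteredPair (fun n => (F n).map (opLinearEquiv R : A ≃ₗ[R] Aᵐᵒᵖ).toLinearMap)
    (MulOpposite.op p) (MulOpposite.op q) N := by
  have key : ∀ n (a : Aᵐᵒᵖ),
      a ∈ (F n).map (opLinearEquiv R : A ≃ₗ[R] Aᵐᵒᵖ).toLinearMap ↔ unop a ∈ F n := by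
    intro n a
    constructor
    · rintro ⟨b, hb, rfl⟩; exact hb
    · intro ha; exact ⟨unop a, ha, rfl⟩
  constructor
  · intro m n hmn a
    rw [key, key]; exact fun ha => h.mono hmn ha
  · intro m n a b
    simp only [key, unop_mul]
    exact fun ha hb => add_comm n m ▸ h.mul_mem hb ha
  · intro n hn
    simp [h.eq_bot n hn]
  · intro a
    obtain ⟨n, hn⟩ := h.exists_mem (unop a)
    exact ⟨n, (key _ _).2 hn⟩
  · exact fun n => (h.fg n).map _
  · exact h.nonneg
  · exact (key _ _).2 h.left_mem
  · exact (key _ _).2 h.right_mem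
  · rw [key]
    have := neg_mem h.comm_mem
    rwa [neg_sub] at this
  · intro a n; simp only [key]; exact h.mem_of_mul_left _ _
  · intro a n; simp only [key]; exact h.mem_of_mul_right _ _
  · intro a b n
    simp only [key]
    intro ha hb hab
    obtain ⟨m, hm, h1, h2⟩ := h.div_left _ _ _ ha hb hab
    exact ⟨MulOpposite.op m, hm, h1, h2⟩
  · intro a b n
    simp only [key]
    intro ha hb hab
    obtain ⟨m, hm, h1, h2⟩ := h.div_right _ _ _ ha hb hab
    exact ⟨MulOpposite.op m, hm, h1, h2⟩
  · intro s n hn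
    simp only [key]
    intro hs
    obtain ⟨c, hc, c', hc', h1⟩ := h.decomp_right _ _ hn hs
    exact ⟨MulOpposite.op c, hc, MulOpposite.op c', hc', h1⟩
  · intro s n hn
    simp only [key]
    intro hs
    obtain ⟨c, hc, c', hc', h1⟩ := h.decomp_left _ _ hn hs
    exact ⟨MulOpposite.op c, hc, MulOpposite.op c', hc', h1⟩

variable {I : Submodule R A} (hpI : p ∈ I) (hqI : q ∈ I)
  (hI : ∀ s ∈ I, ∀ a, s * a ∈ I)
include hpI hqI hI

/-- Induction over the elements of a right ideal containing `p` and `q`. -/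
lemma ideal_induction (P : ℤ → A → Prop) (hzero : P (-1) 0)
    (hlow : ∀ n, 0 ≤ n → ∀ s ∈ I, s ∈ F (2 * N - 2) → P n s)
    (hstep : ∀ n, ∀ c ∈ F (n + 1 - N), ∀ c' ∈ F (n + 1 - N), ∀ r ∈ I, P n r →
      P (n + 1) (p * c + q * c' + r)) (n : ℤ) (hn : -1 ≤ n) :
    ∀ s ∈ I, s ∈ F n → P n s := by
  induction n, hn using Int.leInduction with
  | base => intro s _ hs; rwa [h.eq_zero_of_neg (by norm_num) hs]
  | succ n hn ih =>
    intro s hsI hs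
    -- From degree `2N - 1` on, every symbol lies in the ideal generated by those of `p` and `q`, so
    -- subtracting an element of `I` lowers the degree; smaller degrees are left to `hlow`.
    by_cases hle : 2 * N - 1 ≤ n + 1
    · obtain ⟨c, hc, c', hc', hr⟩ := h.decomp_left s _ hle hs
      rw [add_sub_cancel_right] at hr
      have hrI : s - (p * c + q * c') ∈ I := sub_mem hsI (add_mem (hI _ hpI _) (hI _ hqI _))
      have := hstep n c hc c' hc' _ hrI (ih _ hrI hr)
      rwa [add_sub_cancel] at this
    · exact hlow _ (by omega) s hsI (h.mono (by omega) hs)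

lemma mem_of_ideal_induction (P : A → Prop) (hzero : P 0)
    (hlow : ∀ s ∈ I, s ∈ F (2 * N - 2) → P s)
    (hstep : ∀ c c', ∀ r ∈ I, P r → P (p * c + q * c' + r)) {s : A} (hs : s ∈ I) : P s := by
  obtain ⟨n, hn⟩ := h.exists_mem s
  exact h.ideal_induction hpI hqI hI (fun _ => P) hzero (fun _ _ => hlow)
    (fun _ c _ c' _ r hr => hstep c c' r hr) (max n (-1)) (le_max_right _ _) s hs
    (h.mono (le_max_left _ _) hn)

/-- A right ideal containing `p` and `q` is finitely generated. -/
lemma exists_finset_span [IsNoetherianRing R] :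
    ∃ S : Finset A, (S : Set A) ⊆ I ∧ ∀ s ∈ I, s ∈ Submodule.span Aᵐᵒᵖ (S : Set A) := by
  classical
  -- Besides `p` and `q`, only `R`-generators of the part of `I` of degree at most `2N - 2` are
  -- needed; there are finitely many because `R` is Noetherian.
  obtain ⟨T, hT⟩ := (h.fg (2 * N - 2)).of_le (inf_le_right : I ⊓ F (2 * N - 2) ≤ _)
  refine ⟨insert p (insert q T), ?_, ?_⟩
  · intro a ha
    simp only [Finset.coe_insert, Set.mem_insert_iff, Finset.mem_coe] at ha
    rcases ha with rfl | rfl | ha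
    · exact hpI
    · exact hqI
    · have : a ∈ I ⊓ F (2 * N - 2) := hT ▸ Submodule.subset_span ha
      exact this.1
  · intro s hs
    set W := Submodule.span Aᵐᵒᵖ ((insert p (insert q T) : Finset A) : Set A)
    have hW : ∀ a ∈ W, ∀ c, a * c ∈ W := fun a ha c => W.smul_mem (MulOpposite.op c) ha
    refine h.mem_of_ideal_induction hpI hqI hI (· ∈ W) (zero_mem _) ?_ ?_ hs
    · intro s hsI hs
      have : s ∈ Submodule.span R (T : Set A) := hT ▸ ⟨hsI, hs⟩
      induction this using Submodule.span_induction with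
      | mem a ha => exact Submodule.subset_span (by simp [Finset.mem_coe.1 ha])
      | zero => exact zero_mem _
      | add a b ha hb iha ihb =>
        exact add_mem (iha (hT ▸ ha : a ∈ I ⊓ F (2 * N - 2)).1 (hT ▸ ha : a ∈ I ⊓ F (2 * N - 2)).2)
          (ihb (hT ▸ hb : b ∈ I ⊓ F (2 * N - 2)).1 (hT ▸ hb : b ∈ I ⊓ F (2 * N - 2)).2)
      | smul r a ha iha =>
        rw [Algebra.smul_def, Algebra.commutes]
        exact hW _ (iha (hT ▸ ha : a ∈ I ⊓ F (2 * N - 2)).1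
          (hT ▸ ha : a ∈ I ⊓ F (2 * N - 2)).2) _
    · intro c c' r _ hr
      exact add_mem (add_mem (hW _ (Submodule.subset_span (by simp)) _)
        (hW _ (Submodule.subset_span (by simp)) _)) hr

section Extension

variable {f : A → A} (hadd : ∀ s ∈ I, ∀ t ∈ I, f (s + t) = f s + f t)
  (hmul : ∀ s ∈ I, ∀ a, f (s * a) = f s * a)
include hadd hmul

/-- The map is controlled by its values on `p`, `q` and finitely many `R`-generators of the
low-degree part of `I`. A common bound `D` for the degrees of these values propagates through `p c +
q c' + r`. -/
lemma exists_degree_bound [IsNoetherianRing R] : ∃ d : ℤ, ∀ n, ∀ s ∈ I, s ∈ F n → f s ∈ F (n + d) := by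
  classical
  have hf0 : f 0 = 0 := by simpa using hmul 0 (zero_mem _) 0
  obtain ⟨T, hT⟩ := (h.fg (2 * N - 2)).of_le (inf_le_right : I ⊓ F (2 * N - 2) ≤ _)
  choose deg hdeg using h.exists_mem
  let S : Finset A := insert p (insert q T)
  obtain ⟨D, hD⟩ : ∃ D : ℤ, 0 ≤ D ∧ ∀ a ∈ S, f a ∈ F D := by
    refine ⟨∑ a ∈ S, |deg (f a)|, Finset.sum_nonneg fun _ _ => abs_nonneg _, fun a ha => ?_⟩
    exact h.mono ((le_abs_self _).trans
      (Finset.single_le_sum (f := fun a => |deg (f a)|) (fun _ _ => abs_nonneg _) ha))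
      (hdeg (f a))
  have hlow : ∀ s ∈ I, s ∈ F (2 * N - 2) → f s ∈ F D := by
    intro s hsI hs
    have : s ∈ Submodule.span R (T : Set A) := hT ▸ ⟨hsI, hs⟩
    have hmem : ∀ a ∈ Submodule.span R (T : Set A), a ∈ I := fun a ha =>
      (hT ▸ ha : a ∈ I ⊓ F (2 * N - 2)).1
    clear hs hsI
    induction this using Submodule.span_induction with
    | mem a ha => exact hD.2 a (by simp [S, Finset.mem_coe.1 ha])
    | zero => rw [hf0]; exact zero_mem _
    | add a b ha hb iha ihb =>
      rw [hadd _ (hmem _ ha) _ (hmem _ hb)]; exact add_mem iha ihb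
    | smul r a ha iha =>
      rw [Algebra.smul_def, Algebra.commutes, hmul _ (hmem _ ha), ← Algebra.commutes,
        ← Algebra.smul_def]
      exact Submodule.smul_mem _ _ iha
  refine ⟨D, fun n s hsI hs => ?_⟩
  rcases lt_or_ge n (-1) with hn | hn
  · rw [h.eq_zero_of_neg (by omega) hs, hf0]; exact zero_mem _
  refine h.ideal_induction hpI hqI hI (fun n s => f s ∈ F (n + D)) ?_ ?_ ?_ n hn s hsI hs
  · rw [hf0]; exact zero_mem _
  · exact fun n hn s hsI hs => h.mono (by omega) (hlow s hsI hs)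
  · intro n c hc c' hc' r hrI hr
    have hpc := hI _ hpI c
    have hqc := hI _ hqI c'
    rw [hadd _ (add_mem hpc hqc) _ hrI, hadd _ hpc _ hqc, hmul _ hpI, hmul _ hqI]
    have hN := h.nonneg
    refine add_mem (add_mem (h.mul_mem' (hD.2 p (by simp [S])) hc (by omega))
      (h.mul_mem' (hD.2 q (by simp [S])) hc' (by omega))) (h.mono (by omega) hr)

/-- The degree-lowering step. Since `pq - qp` has degree at most `2N - 1`, so `f(p) q - f(q) p`
falls below its expected degree `2N + d`. Regularity then makes the symbols of `f(p)` and `f(q)`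
multiples, by one common `m`, of those of `p` and `q`. -/
lemma exists_sub_mul_degree_lt {d : ℤ} (hd : ∀ n, ∀ s ∈ I, s ∈ F n → f s ∈ F (n + d)) :
    ∃ m ∈ F d, ∀ n, ∀ s ∈ I, s ∈ F n → f s - m * s ∈ F (n + (d - 1)) := by
  have hN := h.nonneg
  have hf0 : f 0 = 0 := by simpa using hmul 0 (zero_mem _) 0
  have hcomm : f p * q - f q * p = f (p * q - q * p) := by
    have h1 := hadd (p * q - q * p) (sub_mem (hI _ hpI _) (hI _ hqI _)) (q * p) (hI _ hqI _)
    rw [sub_add_cancel, hmul _ hpI, hmul _ hqI] at h1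
    rw [h1, add_sub_cancel_right]
  obtain ⟨m, hm, h1, h2⟩ := h.div_right (f p) (f q) (N + d) (hd _ _ hpI h.left_mem)
    (hd _ _ hqI h.right_mem) (by
      rw [hcomm]
      exact h.mono (by omega) (hd _ _ (sub_mem (hI _ hpI _) (hI _ hqI _)) h.comm_mem))
  have hm' : m ∈ F d := h.mono (by omega) hm
  refine ⟨m, hm', fun n s hsI hs => ?_⟩
  rcases lt_or_ge n 0 with hn | hn
  · rw [h.eq_zero_of_neg hn hs, hf0, mul_zero, sub_zero]; exact zero_mem _
  -- Two factors `p` lift the degree past the threshold `2N - 1` for every `n ≥ 0`, so that `s p p`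
  -- can be expanded through `p` and `q`; both are cancelled at the end.
  have hspp : s * p * p ∈ F (n + 2 * N) :=
    h.mul_mem' (h.mul_mem hs h.left_mem) h.left_mem (by omega)
  obtain ⟨c, hc, c', hc', hr⟩ := h.decomp_left _ (n + 2 * N) (by omega) hspp
  have hpc := hI _ hpI c
  have hqc := hI _ hqI c'
  have hsppI := hI _ (hI _ hsI p) p
  set r := s * p * p - (p * c + q * c') with hrdef
  have hrI : r ∈ I := sub_mem hsppI (add_mem hpc hqc)
  have hs2 : s * p * p = p * c + q * c' + r := by rw [hrdef]; abel
  have key : (f s - m * s) * p * p =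
      (f p - m * p) * c + (f q - m * q) * c' + (f r - m * r) := by
    have h3 : f s * p * p = f p * c + f q * c' + f r := by
      rw [← hmul _ hsI, ← hmul _ (hI _ hsI _), hs2, hadd _ (add_mem hpc hqc) _ hrI,
        hadd _ hpc _ hqc, hmul _ hpI, hmul _ hqI]
    have h4 : m * s * p * p = m * p * c + m * q * c' + m * r := by
      calc m * s * p * p = m * (s * p * p) := by noncomm_ring
        _ = _ := by rw [hs2]; noncomm_ring
    rw [sub_mul, sub_mul, h3, h4]; noncomm_ring
  refine h.mem_of_mul_right _ _ (h.mem_of_mul_right _ _ ?_)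
  rw [key]
  refine add_mem (add_mem (h.mul_mem' h1 hc (by omega)) (h.mul_mem' h2 hc' (by omega)))
    (sub_mem (h.mono (by omega) (hd _ _ hrI hr))
      (h.mul_mem' hm' hr (by omega)))

/-- Every homomorphism of right modules from a right ideal containing `p` and `q` to `A` is a left
multiplication. -/
theorem exists_eq_mul_left [IsNoetherianRing R] : ∃ m, ∀ s ∈ I, f s = m * s := by
  obtain ⟨d, hd⟩ := h.exists_degree_bound hpI hqI hI hadd hmul
  obtain ⟨k, hk⟩ : ∃ k : ℕ, d < k := ⟨(d + 1).toNat, by omega⟩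
  induction k generalizing f d with
  | zero =>
    refine ⟨0, fun s hs => ?_⟩
    -- Here `d < 0`, so each approximating multiplier lies in `F d = 0`. The degree of `f` itself
    -- can therefore be lowered indefinitely, and `f` vanishes on `I`.
    have hbound : ∀ j : ℕ, ∀ n, ∀ s ∈ I, s ∈ F n → f s ∈ F (n + (d - j)) := by
      intro j
      induction j with
      | zero => simpa using hd
      | succ j ih =>
        obtain ⟨m, hm, hm'⟩ := h.exists_sub_mul_degree_lt hpI hqI hI hadd hmul ih
        have : m = 0 := h.eq_zero_of_neg (by push_cast at hk; omega) hm
        intro n s hsI hs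
        have := hm' n s hsI hs
        subst m
        rw [zero_mul, sub_zero] at this
        exact h.mono (by push_cast; omega) this
    obtain ⟨n, hn⟩ := h.exists_mem s
    rw [zero_mul]
    exact h.eq_zero_of_neg (by push_cast at hk; omega) (hbound n.toNat n s hs hn)
  | succ k ih =>
    obtain ⟨m, _, hm⟩ := h.exists_sub_mul_degree_lt hpI hqI hI hadd hmul hd
    obtain ⟨m', hm'⟩ := ih (f := fun s => f s - m * s)
      (fun s hs t ht => by rw [hadd _ hs _ ht]; noncomm_ring)
      (fun s hs a => by rw [hmul _ hs]; noncomm_ring) (d - 1) hm (by push_cast at hk; omega)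
    refine ⟨m + m', fun s hs => ?_⟩
    have := hm' s hs
    rw [add_mul, ← this]; abel

end Extension

end IsFilteredPair

/-- Every homomorphism of left modules from a left ideal containing `p` and `q` to `A` is a right
multiplication. -/
theorem IsFilteredPair.exists_eq_mul_right [IsNoetherianRing R] {F : ℤ → Submodule R A} {p q : A}
    {N : ℤ} (h : IsFilteredPair F p q N) {I : Submodule R A} (hpI : p ∈ I) (hqI : q ∈ I)
    (hI : ∀ s ∈ I, ∀ a, a * s ∈ I) {f : A → A}
    (hadd : ∀ s ∈ I, ∀ t ∈ I, f (s + t) = f s + f t)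
    (hmul : ∀ s ∈ I, ∀ a, f (a * s) = a * f s) : ∃ m, ∀ s ∈ I, f s = s * m := by
  have key : ∀ a : Aᵐᵒᵖ,
      a ∈ I.map (opLinearEquiv R : A ≃ₗ[R] Aᵐᵒᵖ).toLinearMap → unop a ∈ I := by
    rintro _ ⟨b, hb, rfl⟩; exact hb
  obtain ⟨m, hm⟩ := h.op.exists_eq_mul_left (I := I.map (opLinearEquiv R).toLinearMap)
    ⟨p, hpI, rfl⟩ ⟨q, hqI, rfl⟩ (fun s hs a => ⟨unop a * unop s, hI _ (key _ hs) _, rfl⟩)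
    (f := fun a => MulOpposite.op (f (unop a)))
    (fun s hs t ht => congrArg MulOpposite.op (hadd _ (key _ hs) _ (key _ ht)))
    (fun s hs a => congrArg MulOpposite.op (hmul _ (key _ hs) _))
  exact ⟨unop m, fun s hs => congrArg unop (hm (MulOpposite.op s) ⟨s, hs, rfl⟩)⟩

end FilteredPair

/-! ### The trace ideal `AeA` and the bimodules `Ae`, `eA` -/

section Trace

variable (R : Type*) {A : Type*} [CommRing R] [Ring A] [Algebra R A]

/-- The two-sided ideal `AeA`, as an `R`-submodule of `A`. -/
def traceIdeal (e : A) : Submodule R A :=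
  Submodule.span R {s | ∃ a b, s = a * e * b}

variable {R} {e : A}

lemma mul_mul_mem_traceIdeal (a b : A) : a * e * b ∈ traceIdeal R e :=
  Submodule.subset_span ⟨a, b, rfl⟩

lemma mul_mem_traceIdeal_right {s : A} (hs : s ∈ traceIdeal R e) (c : A) :
    s * c ∈ traceIdeal R e := by
  induction hs using Submodule.span_induction with
  | mem s hs =>
    obtain ⟨a, b, rfl⟩ := hs
    rw [mul_assoc]; exact mul_mul_mem_traceIdeal a (b * c)
  | zero => rw [zero_mul]; exact zero_mem _
  | add s t _ _ hs ht => rw [add_mul]; exact add_mem hs ht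
  | smul r s _ hs => rw [smul_mul_assoc]; exact Submodule.smul_mem _ _ hs

lemma mul_mem_traceIdeal_left {s : A} (hs : s ∈ traceIdeal R e) (c : A) :
    c * s ∈ traceIdeal R e := by
  induction hs using Submodule.span_induction with
  | mem s hs =>
    obtain ⟨a, b, rfl⟩ := hs
    rw [← mul_assoc, ← mul_assoc]; exact mul_mul_mem_traceIdeal (c * a) b
  | zero => rw [mul_zero]; exact zero_mem _
  | add s t _ _ hs ht => rw [mul_add]; exact add_mem hs ht
  | smul r s _ hs => rw [mul_smul_comm]; exact Submodule.smul_mem _ _ hs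

lemma mul_eq_zero_of_mem_traceIdeal {z s : A} (hz : ∀ a, z * (a * e) = 0)
    (hs : s ∈ traceIdeal R e) : z * s = 0 := by
  induction hs using Submodule.span_induction with
  | mem s hs =>
    obtain ⟨a, b, rfl⟩ := hs
    rw [← mul_assoc, hz, zero_mul]
  | zero => rw [mul_zero]
  | add s t _ _ hs ht => rw [mul_add, hs, ht, add_zero]
  | smul r s _ hs => rw [mul_smul_comm, hs, smul_zero]

lemma eq_zero_mul_of_mem_traceIdeal {z s : A} (hz : ∀ b, e * b * z = 0)
    (hs : s ∈ traceIdeal R e) : s * z = 0 := by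
  induction hs using Submodule.span_induction with
  | mem s hs =>
    obtain ⟨a, b, rfl⟩ := hs
    rw [mul_assoc, mul_assoc, ← mul_assoc e, hz, mul_zero]
  | zero => rw [zero_mul]
  | add s t _ _ hs ht => rw [add_mul, hs, ht, add_zero]
  | smul r s _ hs => rw [smul_mul_assoc, hs, smul_zero]

variable (he : IsIdempotentElem e)

/-- `a e` as an element of the left ideal `A e`. -/
def peirceMk (e a : A) : (Ideal.span {e} : Ideal A) :=
  ⟨a * e, Ideal.mem_span_singleton'.2 ⟨a, rfl⟩⟩

/-- `e a e` as an element of the corner ring `e A e`. -/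
def cornerMk (a : A) : he.Corner :=
  ⟨e * a * e, (Subsemigroup.mem_corner_iff he).2
    ⟨by rw [← mul_assoc, ← mul_assoc, he.eq], by rw [mul_assoc, he.eq]⟩⟩

@[simp] lemma coe_peirceMk (a : A) : (peirceMk e a : A) = a * e := rfl

lemma coe_cornerMk (a : A) : (cornerMk he a).1 = e * a * e := rfl

lemma cornerMk_smul_peirceMk (a b : A) :
    MulOpposite.op (cornerMk he b) • peirceMk e a = peirceMk e (a * e * b) := by
  refine Subtype.ext ?_
  change a * e * (e * b * e) = a * e * b * e
  simp only [mul_assoc]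
  rw [← mul_assoc e e, he.eq]

lemma corner_mul_left (c : he.Corner) : e * c.1 = c.1 :=
  ((Subsemigroup.mem_corner_iff he).1 c.2).1

lemma corner_mul_right (c : he.Corner) : c.1 * e = c.1 :=
  ((Subsemigroup.mem_corner_iff he).1 c.2).2

/-- Left multiplication by an element of `A` on the right module `A e`. -/
def mulLeftEnd : A →+* Module.End he.Cornerᵐᵒᵖ (Ideal.span {e} : Ideal A) where
  toFun a :=
    { toFun := fun m => a • m
      map_add' := smul_add a
      map_smul' := fun c m => Subtype.ext (mul_assoc a m.1 (unop c).1).symm }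
  map_one' := by ext m; simp
  map_mul' a b := by ext m; simp [mul_assoc]
  map_zero' := by ext m; simp
  map_add' a b := by ext m; simp [add_mul]

lemma coe_mulLeftEnd (a : A) (m : (Ideal.span {e} : Ideal A)) :
    (mulLeftEnd he a m : A) = a * m := rfl

/-- Left multiplication by `e b` as a homomorphism of right modules from `A e` to `e A e`. -/
def mulLeftDual (b : A) : (Ideal.span {e} : Ideal A) →ₗ[he.Cornerᵐᵒᵖ] he.Corner where
  toFun m := ⟨e * b * m.1, (Subsemigroup.mem_corner_iff he).2
    ⟨by rw [← mul_assoc, ← mul_assoc, he.eq],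
      by rw [mul_assoc, mul_idem_of_mem he m.2]⟩⟩
  map_add' m n := Subtype.ext (mul_add _ _ _)
  map_smul' c m := Subtype.ext (mul_assoc (e * b) m.1 (unop c).1).symm

lemma coe_mulLeftDual (b : A) (m : (Ideal.span {e} : Ideal A)) :
    (mulLeftDual he b m).1 = e * b * m := rfl

variable [IsNoetherianRing R] {F : ℤ → Submodule R A} {p q : A} {N : ℤ}
  (h : IsFilteredPair F p q N) (hp : p ∈ traceIdeal R e) (hq : q ∈ traceIdeal R e)
include h hp hq

/-- An additive map `φ : A e → A` which is right `e A e`-linear is a left multiplication. -/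
lemma exists_mul_left_of_linear (φ : (Ideal.span {e} : Ideal A) →+ A)
    (hφ : ∀ m (c : he.Corner), φ (MulOpposite.op c • m) = φ m * c.1) :
    ∃ a : A, ∀ m, φ m = a * m.1 := by
  -- This extends `φ` to `AeA` by `a e b ↦ φ(ae) b`. Describing the value by its products with all
  -- `c e`, rather than by a formula, avoids checking independence of the expression of `s`.
  have hex : ∀ s ∈ traceIdeal R e, ∃ z, ∀ c, z * (c * e) = φ (peirceMk e (s * c)) := by
    intro s hs
    induction hs using Submodule.span_induction with
    | mem s hs =>
      obtain ⟨a, b, rfl⟩ := hs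
      refine ⟨φ (peirceMk e a) * b, fun c => ?_⟩
      have : peirceMk e (a * e * b * c)
          = MulOpposite.op (cornerMk he (b * c)) • peirceMk e a := by
        rw [cornerMk_smul_peirceMk, mul_assoc (a * e)]
      rw [this, hφ]
      have h1 : φ (peirceMk e a) * e = φ (peirceMk e a) := by
        have := hφ (peirceMk e a) 1
        rw [MulOpposite.op_one, one_smul] at this
        exact this.symm
      rw [coe_cornerMk]
      simp only [mul_assoc]
      rw [← mul_assoc _ e, h1]
    | zero =>
      refine ⟨0, fun c => ?_⟩
      have : peirceMk e (0 * c) = 0 := by ext; simp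
      rw [this, map_zero, zero_mul]
    | add s t _ _ hs ht =>
      obtain ⟨z, hz⟩ := hs
      obtain ⟨w, hw⟩ := ht
      refine ⟨z + w, fun c => ?_⟩
      have : peirceMk e ((s + t) * c) = peirceMk e (s * c) + peirceMk e (t * c) := by
        ext; simp [add_mul]
      rw [this, map_add, ← hz, ← hw, add_mul]
    | smul r s _ hs =>
      obtain ⟨z, hz⟩ := hs
      refine ⟨z * algebraMap R A r, fun c => ?_⟩
      have : (r • s) * c = s * (algebraMap R A r * c) := by
        rw [Algebra.smul_def, Algebra.commutes, mul_assoc]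
      rw [this, ← hz, mul_assoc, mul_assoc]
  choose! f hf using hex
  -- An element annihilating `Ae` from the left annihilates `AeA`, which contains the
  -- right-cancellable element `p`.
  have huniq : ∀ z w, (∀ c, z * (c * e) = w * (c * e)) → z = w := by
    intro z w hzw
    rw [← sub_eq_zero]
    refine h.eq_zero_of_mul_right (mul_eq_zero_of_mem_traceIdeal (fun a => ?_) hp)
    rw [sub_mul, hzw, sub_self]
  obtain ⟨m, hm⟩ := h.exists_eq_mul_left hp hq (fun s hs a => mul_mem_traceIdeal_right hs a)
    (f := f) (fun s hs t ht => huniq _ _ fun c => by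
      rw [hf _ (add_mem hs ht), add_mul (f s), hf _ hs, hf _ ht, ← map_add]
      congr 1; ext; simp [add_mul])
    (fun s hs a => huniq _ _ fun c => by
      rw [hf _ (mul_mem_traceIdeal_right hs a), mul_assoc (f s), ← mul_assoc a, hf _ hs,
        mul_assoc s])
  refine ⟨m, fun x => ?_⟩
  have hx : x.1 * e = x.1 := mul_idem_of_mem he x.2
  have hxI : x.1 ∈ traceIdeal R e := by
    have := mul_mul_mem_traceIdeal (R := R) (e := e) x.1 1
    rwa [hx, mul_one] at this
  have h1 := hf _ hxI 1
  rw [hm _ hxI, one_mul, mul_one, mul_assoc, hx] at h1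
  rw [h1]; congr 1; ext; exact hx.symm

/-- A left `e A e`-linear map `ψ : e A → A` is a right multiplication. -/
lemma exists_mul_right_of_linear (he : IsIdempotentElem e) (ψ : A →+ A)
    (hψ : ∀ c b, ψ (e * c * e * b) = e * c * e * ψ b) :
    ∃ a : A, ∀ b, e * ψ (e * b) = e * b * a := by
  -- The mirror extension, `a e b ↦ a e ψ(b)`.
  have hex : ∀ s ∈ traceIdeal R e, ∃ z, ∀ c, e * c * z = ψ (e * c * s) := by
    intro s hs
    induction hs using Submodule.span_induction with
    | mem s hs =>
      obtain ⟨a, b, rfl⟩ := hs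
      refine ⟨a * e * ψ b, fun c => ?_⟩
      have := hψ (c * a) b
      simp only [mul_assoc] at this ⊢
      exact this.symm
    | zero => exact ⟨0, fun c => by simp⟩
    | add s t _ _ hs ht =>
      obtain ⟨z, hz⟩ := hs
      obtain ⟨w, hw⟩ := ht
      exact ⟨z + w, fun c => by rw [mul_add, mul_add, map_add, hz, hw]⟩
    | smul r s _ hs =>
      obtain ⟨z, hz⟩ := hs
      refine ⟨algebraMap R A r * z, fun c => ?_⟩
      have := hz (c * algebraMap R A r)
      rw [Algebra.smul_def]
      simp only [mul_assoc] at this ⊢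
      exact this
  choose! f hf using hex
  have huniq : ∀ z w, (∀ c, e * c * z = e * c * w) → z = w := by
    intro z w hzw
    rw [← sub_eq_zero]
    refine h.eq_zero_of_mul_left (eq_zero_mul_of_mem_traceIdeal (fun a => ?_) hp)
    rw [mul_sub, hzw, sub_self]
  obtain ⟨m, hm⟩ := h.exists_eq_mul_right hp hq (fun s hs a => mul_mem_traceIdeal_left hs a)
    (f := f) (fun s hs t ht => huniq _ _ fun c => by
      rw [hf _ (add_mem hs ht), mul_add, mul_add _ (f s), hf _ hs, hf _ ht, map_add])
    (fun s hs a => huniq _ _ fun c => by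
      have := hf _ hs (c * a)
      rw [hf _ (mul_mem_traceIdeal_left hs a)]
      simp only [mul_assoc] at this ⊢
      exact this.symm)
  refine ⟨m, fun b => ?_⟩
  have hbI : e * b ∈ traceIdeal R e := by
    have := mul_mul_mem_traceIdeal (R := R) (e := e) 1 b
    rwa [one_mul] at this
  have h1 := hf _ hbI 1
  have h2 := hψ 1 b
  simp only [hm _ hbI, mul_one, ← mul_assoc, he.eq] at h1 h2
  rw [← h1, ← mul_assoc, ← mul_assoc, he.eq]

/-- `A e` is a finitely generated right `e A e`-module. -/
theorem peirce_finite : Module.Finite he.Cornerᵐᵒᵖ (Ideal.span {e} : Ideal A) := by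
  classical
  obtain ⟨S, hSI, hS⟩ := h.exists_finset_span hp hq
    (fun s hs a => mul_mem_traceIdeal_right hs a)
  -- If `s = ∑ aᵢ e bᵢ`, then `s c e = ∑ (aᵢ e)(e bᵢ c e)`, so the finitely many `aᵢ e` serve all
  -- `c` at once.
  choose! T hT using fun s (hs : s ∈ traceIdeal R e) =>
    show ∃ T : Finset A, ∀ c, peirceMk e (s * c) ∈
      Submodule.span he.Cornerᵐᵒᵖ (peirceMk e '' (T : Set A)) by
    induction hs using Submodule.span_induction with
    | mem s hs =>
      obtain ⟨a, b, rfl⟩ := hs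
      refine ⟨{a}, fun c => ?_⟩
      have : peirceMk e (a * e * b * c)
          = MulOpposite.op (cornerMk he (b * c)) • peirceMk e a := by
        rw [cornerMk_smul_peirceMk, mul_assoc (a * e)]
      rw [this]
      exact Submodule.smul_mem _ _ (Submodule.subset_span (by simp))
    | zero =>
      refine ⟨∅, fun c => ?_⟩
      have : peirceMk e (0 * c) = 0 := by ext; simp
      rw [this]; exact zero_mem _
    | add s t _ _ hs ht =>
      obtain ⟨T, hT⟩ := hs
      obtain ⟨T', hT'⟩ := ht
      refine ⟨T ∪ T', fun c => ?_⟩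
      have : peirceMk e ((s + t) * c) = peirceMk e (s * c) + peirceMk e (t * c) := by
        ext; simp [add_mul]
      rw [this]
      exact add_mem (Submodule.span_mono (Set.image_mono (by simp)) (hT c))
        (Submodule.span_mono (Set.image_mono (by simp)) (hT' c))
    | smul r s _ hs =>
      obtain ⟨T, hT⟩ := hs
      refine ⟨T, fun c => ?_⟩
      have : (r • s) * c = s * (algebraMap R A r * c) := by
        rw [Algebra.smul_def, Algebra.commutes, mul_assoc]
      rw [this]; exact hT _
  refine ⟨⟨(S.biUnion T).image (peirceMk e), ?_⟩⟩
  rw [Finset.coe_image, eq_top_iff]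
  rintro x -
  set W := Submodule.span he.Cornerᵐᵒᵖ (peirceMk e '' ((S.biUnion T : Finset A) : Set A))
  have hx : x.1 * e = x.1 := mul_idem_of_mem he x.2
  have hxI : x.1 ∈ traceIdeal R e := by
    have := mul_mul_mem_traceIdeal (R := R) (e := e) x.1 1
    rwa [hx, mul_one] at this
  have key : ∀ s ∈ Submodule.span Aᵐᵒᵖ (S : Set A), ∀ c, peirceMk e (s * c) ∈ W := by
    intro s hs
    induction hs using Submodule.span_induction with
    | mem s hs =>
      intro c
      refine Submodule.span_mono (Set.image_mono ?_) (hT s (hSI hs) c)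
      exact_mod_cast Finset.subset_biUnion_of_mem T hs
    | zero =>
      intro c
      have : peirceMk e (0 * c) = 0 := by ext; simp
      rw [this]; exact zero_mem _
    | add s t _ _ hs ht =>
      intro c
      have : peirceMk e ((s + t) * c) = peirceMk e (s * c) + peirceMk e (t * c) := by
        ext; simp [add_mul]
      rw [this]; exact add_mem (hs c) (ht c)
    | smul a s _ hs =>
      intro c
      have := hs (unop a * c)
      rwa [← mul_assoc] at this
  have := key _ (hS _ hxI) 1
  have hx' : peirceMk e (x.1 * 1) = x := by ext; simpa using hx
  rwa [hx'] at this

/-- `A` is the endomorphism ring of the right `e A e`-module `A e`. -/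
theorem mulLeftEnd_bijective : Function.Bijective (mulLeftEnd he) := by
  refine ⟨(injective_iff_map_eq_zero _).2 fun a ha => ?_, fun φ => ?_⟩
  · refine h.eq_zero_of_mul_right (mul_eq_zero_of_mem_traceIdeal (fun b => ?_) hp)
    exact congrArg Subtype.val (LinearMap.congr_fun ha (peirceMk e b))
  · obtain ⟨a, ha⟩ := exists_mul_left_of_linear he h hp hq
      ((Submodule.subtype (Ideal.span {e} : Ideal A)).toAddMonoidHom.comp φ.toAddMonoidHom)
      (fun m c => congrArg Subtype.val (map_smul φ (MulOpposite.op c) m))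
    exact ⟨a, LinearMap.ext fun m => Subtype.ext (ha m).symm⟩

/-- The right `e A e`-module `A e` is reflexive. -/
theorem peirce_isReflexiveRight :
    IsReflexiveRight he.Corner (Ideal.span {e} : Ideal A) := by
  refine ⟨(injective_iff_map_eq_zero _).2 fun m hm => ?_, fun Ψ => ?_⟩
  · refine Subtype.ext (h.eq_zero_of_mul_left (eq_zero_mul_of_mem_traceIdeal (fun b => ?_) hp))
    exact congrArg Subtype.val (LinearMap.congr_fun hm (mulLeftDual he b))
  -- Through `b ↦ mulLeftDual he b` the dual of `Ae` becomes `eA`, and `Ψ` becomes a left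
  -- `eAe`-linear map on `eA`, hence a right multiplication.
  · let ψ : A →+ A :=
      { toFun := fun b => (Ψ (mulLeftDual he b)).1
        map_zero' := by
          have : mulLeftDual he (0 : A) = 0 := by
            ext m; exact Subtype.ext (by rw [coe_mulLeftDual, mul_zero, zero_mul]; rfl)
          rw [this, map_zero]; rfl
        map_add' := fun a b => by
          have : mulLeftDual he (a + b) = mulLeftDual he a + mulLeftDual he b := by
            ext m
            exact Subtype.ext (by rw [coe_mulLeftDual, mul_add, add_mul]; rfl)
          rw [this, map_add]; rfl }
    obtain ⟨m, hm⟩ := exists_mul_right_of_linear h hp hq he ψ (fun c b => by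
      have : mulLeftDual he (e * c * e * b) = cornerMk he c • mulLeftDual he b := by
        ext x
        refine Subtype.ext ?_
        change e * (e * c * e * b) * x.1 = e * c * e * (e * b * x.1)
        simp only [mul_assoc]
        rw [← mul_assoc e e, he.eq, ← mul_assoc e e (b * _), he.eq]
      change (Ψ (mulLeftDual he (e * c * e * b))).1 = _
      rw [this, map_smul]; rfl)
    have hψ : ∀ b, ψ b = e * b * m := fun b => by
      rw [← hm b]
      have h1 : mulLeftDual he (e * b) = mulLeftDual he b := by
        ext x
        refine Subtype.ext ?_
        change e * (e * b) * x.1 = e * b * x.1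
        rw [← mul_assoc e e, he.eq]
      change _ = e * (Ψ (mulLeftDual he (e * b))).1
      rw [h1, corner_mul_left]; rfl
    refine ⟨peirceMk e m, LinearMap.ext fun f => Subtype.ext ?_⟩
    -- No functional is missed: every `f` in the dual is left multiplication by some `e a`, where
    -- `Ψ` has just been computed.
    obtain ⟨a, ha⟩ := exists_mul_left_of_linear he h hp hq
      (AddMonoidHom.mk' (fun x => (f x).1) (fun x y => congrArg Subtype.val (map_add f x y)))
      (fun x c => congrArg Subtype.val (map_smul f (MulOpposite.op c) x))
    have hf : f = mulLeftDual he a := by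
      ext x
      refine Subtype.ext ?_
      have h1 : (f x).1 = a * x.1 := ha x
      rw [coe_mulLeftDual, mul_assoc, ← h1, corner_mul_left]
    change (f (peirceMk e m)).1 = (Ψ f).1
    rw [hf, coe_mulLeftDual, coe_peirceMk, ← mul_assoc, ← hψ]
    exact corner_mul_right he _

end Trace

/-! ### The PBW representation on ordered monomials -/

section PBW

variable {R G : Type*} [CommRing R]

variable (R G) in
/-- The free module on the symbols `x ^ i y ^ j g`. -/
abbrev PBWModule : Type _ := (ℕ × ℕ × G) →₀ R

variable (R) in
/-- The basis vector `x ^ i y ^ j g`. -/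
def pbwVec (i j : ℕ) (g : G) : PBWModule R G := Finsupp.single (i, j, g) 1

lemma pbw_ext {M : Type*} [AddCommGroup M] [Module R M] {f g : PBWModule R G →ₗ[R] M}
    (h : ∀ i j k, f (pbwVec R i j k) = g (pbwVec R i j k)) : f = g :=
  Finsupp.lhom_ext' fun ⟨i, j, k⟩ => LinearMap.ext_ring (h i j k)

variable (R G) in
/-- The span of the `x ^ i y ^ j g` with `i + j < n`. -/
def pbwLow (n : ℕ) : Submodule R (PBWModule R G) :=
  Finsupp.supported R R {t | t.1 + t.2.1 < n}

lemma pbwVec_mem_low {i j n : ℕ} {g : G} (h : i + j < n) : pbwVec R i j g ∈ pbwLow R G n :=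
  Finsupp.single_mem_supported _ _ h

lemma pbwLow_mono {m n : ℕ} (h : m ≤ n) : pbwLow R G m ≤ pbwLow R G n :=
  Finsupp.supported_mono fun _ ht => lt_of_lt_of_le ht h

lemma pbwLow_eq_span (n : ℕ) :
    pbwLow R G n = Submodule.span R {v | ∃ i j g, i + j < n ∧ v = pbwVec R i j g} := by
  rw [pbwLow, Finsupp.supported_eq_span_single]
  congr 1
  ext v
  constructor
  · rintro ⟨⟨i, j, g⟩, h, rfl⟩; exact ⟨i, j, g, h, rfl⟩
  · rintro ⟨i, j, g, h, rfl⟩; exact ⟨(i, j, g), h, rfl⟩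

lemma pbwLow_map {M : Type*} [AddCommGroup M] [Module R M] {f : PBWModule R G →ₗ[R] M} {n : ℕ}
    {W : Submodule R M} (h : ∀ i j g, i + j < n → f (pbwVec R i j g) ∈ W)
    {m : PBWModule R G} (hm : m ∈ pbwLow R G n) : f m ∈ W := by
  rw [pbwLow_eq_span] at hm
  have : Submodule.span R {v | ∃ i j g, i + j < n ∧ v = pbwVec R i j g} ≤ W.comap f := by
    rw [Submodule.span_le]
    rintro _ ⟨i, j, g, hij, rfl⟩
    exact h i j g hij
  exact this hm

lemma pbwLow_ext {M : Type*} [AddCommGroup M] [Module R M] {f g : PBWModule R G →ₗ[R] M} {n : ℕ}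
    (h : ∀ i j k, i + j < n → f (pbwVec R i j k) = g (pbwVec R i j k))
    {m : PBWModule R G} (hm : m ∈ pbwLow R G n) : f m = g m := by
  rw [pbwLow_eq_span] at hm
  refine LinearMap.eqOn_span ?_ hm
  rintro _ ⟨i, j, k, hij, rfl⟩
  exact h i j k hij

variable (R G) in
/-- Multiplication by `x`. -/
def pbwX : Module.End R (PBWModule R G) :=
  Finsupp.lmapDomain R R fun t => (t.1 + 1, t.2)

@[simp] lemma pbwX_vec (i j : ℕ) (g : G) : pbwX R G (pbwVec R i j g) = pbwVec R (i + 1) j g := by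
  simp [pbwX, pbwVec, Finsupp.lmapDomain_apply, Finsupp.mapDomain_single]

lemma pbwX_mem_low {n : ℕ} {m : PBWModule R G} (hm : m ∈ pbwLow R G n) :
    pbwX R G m ∈ pbwLow R G (n + 1) :=
  pbwLow_map (fun i j g h => by rw [pbwX_vec]; exact pbwVec_mem_low (by omega)) hm

/-- `a 0 * x + a 1 * y`, where `y` acts by `Y`. -/
def linOp (a : Fin 2 → R) (Y : Module.End R (PBWModule R G)) : Module.End R (PBWModule R G) :=
  a 0 • pbwX R G + a 1 • Y

lemma linOp_apply (a : Fin 2 → R) (Y : Module.End R (PBWModule R G)) (m : PBWModule R G) :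
    linOp a Y m = a 0 • pbwX R G m + a 1 • Y m := rfl

variable [Group G] (c : G → Matrix (Fin 2) (Fin 2) R)

/-- The action of `g`, where `g` acts on the linear forms by the matrix `c g` and `y` acts by
`Y`. -/
def actOp (Y : Module.End R (PBWModule R G)) (g : G) : Module.End R (PBWModule R G) :=
  Finsupp.linearCombination R fun t =>
    (linOp (c g 0) Y ^ t.1) ((linOp (c g 1) Y ^ t.2.1) (pbwVec R 0 0 (g * t.2.2)))

lemma actOp_vec (Y : Module.End R (PBWModule R G)) (g : G) (i j : ℕ) (k : G) :
    actOp c Y g (pbwVec R i j k) =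
      (linOp (c g 0) Y ^ i) ((linOp (c g 1) Y ^ j) (pbwVec R 0 0 (g * k))) := by
  simp [actOp, pbwVec, Finsupp.linearCombination_single]

variable [Fintype G] (τ : G → R)

/-- One step of the recursion which determines the action of `y`. -/
def stepY (Y : Module.End R (PBWModule R G)) : Module.End R (PBWModule R G) :=
  Finsupp.linearCombination R fun t =>
    match t with
    | (0, j, k) => pbwVec R 0 (j + 1) k
    -- The rule `y x = x y - τ`. The right side applies `Y`, directly or through the group action,
    -- only to vectors of degree at most `i + j`.
    | (i + 1, j, k) =>
      pbwX R G (Y (pbwVec R i j k)) - ∑ g, τ g • actOp c Y g (pbwVec R i j k)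

lemma stepY_vec_zero (Y : Module.End R (PBWModule R G)) (j : ℕ) (k : G) :
    stepY c τ Y (pbwVec R 0 j k) = pbwVec R 0 (j + 1) k := by
  simp [stepY, pbwVec, Finsupp.linearCombination_single]

lemma stepY_vec_succ (Y : Module.End R (PBWModule R G)) (i j : ℕ) (k : G) :
    stepY c τ Y (pbwVec R (i + 1) j k) =
      pbwX R G (Y (pbwVec R i j k)) - ∑ g, τ g • actOp c Y g (pbwVec R i j k) := by
  simp [stepY, pbwVec, Finsupp.linearCombination_single]

/-- `Y` raises degrees by at most one. -/
def IsDegOne (Y : Module.End R (PBWModule R G)) : Prop :=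
  ∀ n, ∀ m ∈ pbwLow R G n, Y m ∈ pbwLow R G (n + 1)

variable {c τ} {Y Y' : Module.End R (PBWModule R G)}

omit [Group G] [Fintype G] in
lemma IsDegOne.linOp_pow (hY : IsDegOne Y) (a : Fin 2 → R) (i : ℕ) {n : ℕ} {m : PBWModule R G}
    (hm : m ∈ pbwLow R G n) : (linOp a Y ^ i) m ∈ pbwLow R G (n + i) := by
  induction i with
  | zero => simpa using hm
  | succ i ih =>
    rw [pow_succ', Module.End.mul_apply, linOp_apply]
    exact add_mem (Submodule.smul_mem _ _ (pbwX_mem_low ih)) (Submodule.smul_mem _ _ (hY _ _ ih))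

omit [Fintype G] in
lemma IsDegOne.actOp_mem (hY : IsDegOne Y) (g : G) {n : ℕ} {m : PBWModule R G}
    (hm : m ∈ pbwLow R G n) : actOp c Y g m ∈ pbwLow R G n := by
  refine pbwLow_map (fun i j k h => ?_) hm
  rw [actOp_vec]
  exact pbwLow_mono (by omega) (hY.linOp_pow _ i (hY.linOp_pow _ j
    (pbwVec_mem_low (n := 1) (by omega))))

lemma IsDegOne.stepY (hY : IsDegOne Y) : IsDegOne (stepY c τ Y) := by
  intro n m hm
  refine pbwLow_map (fun i j k h => ?_) hm
  cases i with
  | zero => rw [stepY_vec_zero]; exact pbwVec_mem_low (by omega)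
  | succ i =>
    have h1 : pbwVec R i j k ∈ pbwLow R G (i + j + 1) := pbwVec_mem_low (by omega)
    rw [stepY_vec_succ]
    refine sub_mem (pbwLow_mono (by omega) (pbwX_mem_low (hY _ _ h1)))
      (sum_mem fun g _ => Submodule.smul_mem _ _ (pbwLow_mono (by omega) (hY.actOp_mem g h1)))

omit [Group G] [Fintype G] in
lemma linOp_pow_congr (hY : IsDegOne Y) {n : ℕ} (h : ∀ m ∈ pbwLow R G n, Y m = Y' m)
    (a : Fin 2 → R) (i : ℕ) {k : ℕ} (hk : k + i ≤ n) {m : PBWModule R G}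
    (hm : m ∈ pbwLow R G (k + 1)) : (linOp a Y ^ i) m = (linOp a Y' ^ i) m := by
  induction i with
  | zero => simp
  | succ i ih =>
    rw [pow_succ', pow_succ', Module.End.mul_apply, Module.End.mul_apply, ← ih (by omega),
      linOp_apply, linOp_apply, h _ (pbwLow_mono (by omega) (hY.linOp_pow a i hm))]

omit [Fintype G] in
lemma actOp_congr (hY : IsDegOne Y) {n : ℕ} (h : ∀ m ∈ pbwLow R G n, Y m = Y' m) (g : G)
    {i j : ℕ} (hij : i + j ≤ n) (k : G) :
    actOp c Y g (pbwVec R i j k) = actOp c Y' g (pbwVec R i j k) := by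
  have h0 : pbwVec R 0 0 (g * k) ∈ pbwLow R G (0 + 1) := pbwVec_mem_low (by omega)
  rw [actOp_vec, actOp_vec, ← linOp_pow_congr hY h _ j (by omega) h0]
  exact linOp_pow_congr hY h _ i (k := j) (by omega)
    (pbwLow_mono (by omega) (hY.linOp_pow _ j h0))

/-- The recursion consults `Y` only in smaller degrees, so each iteration extends agreement by one
degree. This makes the iterates stabilise degree by degree. -/
lemma stepY_congr (hY : IsDegOne Y) {n : ℕ} (h : ∀ m ∈ pbwLow R G n, Y m = Y' m) :
    ∀ m ∈ pbwLow R G (n + 1), stepY c τ Y m = stepY c τ Y' m := by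
  intro m hm
  refine pbwLow_ext (fun i j k hij => ?_) hm
  cases i with
  | zero => rw [stepY_vec_zero, stepY_vec_zero]
  | succ i =>
    rw [stepY_vec_succ, stepY_vec_succ, h _ (pbwVec_mem_low (by omega))]
    simp_rw [actOp_congr hY h _ (show i + j ≤ n by omega)]

variable (c τ)

/-- The `n`-th approximation to the action of `y`, correct in degrees less than `n`. -/
def approxY (n : ℕ) : Module.End R (PBWModule R G) := (stepY c τ)^[n] 0

lemma approxY_succ (n : ℕ) : approxY c τ (n + 1) = stepY c τ (approxY c τ n) :=
  Function.iterate_succ_apply' _ _ _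

lemma isDegOne_approxY (n : ℕ) : IsDegOne (approxY c τ n) := by
  induction n with
  | zero => intro n m _; exact zero_mem _
  | succ n ih => rw [approxY_succ]; exact ih.stepY

lemma approxY_stable {n k : ℕ} (hnk : n ≤ k) :
    ∀ m ∈ pbwLow R G n, approxY c τ n m = approxY c τ k m := by
  induction n generalizing k with
  | zero =>
    intro m hm
    have : m = 0 := by simpa [pbwLow] using hm
    rw [this, map_zero, map_zero]
  | succ n ih =>
    obtain ⟨k, rfl⟩ : ∃ k', k = k' + 1 := ⟨k - 1, by omega⟩
    rw [approxY_succ, approxY_succ]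
    exact stepY_congr (isDegOne_approxY c τ n) (ih (by omega))

/-- The action of `y`. -/
def pbwY : Module.End R (PBWModule R G) :=
  Finsupp.linearCombination R fun t =>
    approxY c τ (t.1 + t.2.1 + 1) (pbwVec R t.1 t.2.1 t.2.2)

lemma pbwY_eq_approxY (n : ℕ) : ∀ m ∈ pbwLow R G n, pbwY c τ m = approxY c τ n m := by
  intro m hm
  refine pbwLow_ext (fun i j k hij => ?_) hm
  rw [← approxY_stable c τ (n := i + j + 1) (by omega) _ (pbwVec_mem_low (by omega))]
  simp [pbwY, pbwVec, Finsupp.linearCombination_single]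

lemma isDegOne_pbwY : IsDegOne (pbwY c τ) := fun n m hm => by
  rw [pbwY_eq_approxY c τ n m hm]; exact isDegOne_approxY c τ n n m hm

/-- The limit is a fixed point of the recursion; the commutation relation is read off from this. -/
lemma stepY_pbwY : stepY c τ (pbwY c τ) = pbwY c τ := by
  refine pbw_ext fun i j k => ?_
  have h : pbwVec R i j k ∈ pbwLow R G (i + j + 1) := pbwVec_mem_low (by omega)
  rw [stepY_congr (isDegOne_pbwY c τ) (pbwY_eq_approxY c τ (i + j)) _ h, ← approxY_succ,
    ← pbwY_eq_approxY c τ _ _ h]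

lemma pbwY_vec_zero (j : ℕ) (k : G) : pbwY c τ (pbwVec R 0 j k) = pbwVec R 0 (j + 1) k := by
  rw [← stepY_pbwY, stepY_vec_zero]

/-- The action of `g` on `PBWModule`. -/
def pbwG (g : G) : Module.End R (PBWModule R G) := actOp c (pbwY c τ) g

lemma pbwG_vec (g : G) (i j : ℕ) (k : G) : pbwG c τ g (pbwVec R i j k) =
    (linOp (c g 0) (pbwY c τ) ^ i) ((linOp (c g 1) (pbwY c τ) ^ j) (pbwVec R 0 0 (g * k))) :=
  actOp_vec c _ g i j k

/-- The commutation relation `x y - y x = τ`. -/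
lemma pbw_comm : pbwX R G * pbwY c τ - pbwY c τ * pbwX R G = ∑ g, τ g • pbwG c τ g := by
  refine pbw_ext fun i j k => ?_
  rw [LinearMap.sub_apply, Module.End.mul_apply, Module.End.mul_apply, pbwX_vec]
  conv_lhs => rw [← stepY_pbwY, stepY_vec_succ, stepY_pbwY]
  simp [pbwG]

lemma pbwG_mul_pbwX (g : G) :
    pbwG c τ g * pbwX R G = linOp (c g 0) (pbwY c τ) * pbwG c τ g := by
  refine pbw_ext fun i j k => ?_
  rw [Module.End.mul_apply, Module.End.mul_apply, pbwX_vec, pbwG_vec, pbwG_vec, pow_succ',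
    Module.End.mul_apply]

lemma pbwG_pbwY_vec_zero (g : G) (j : ℕ) (k : G) :
    pbwG c τ g (pbwY c τ (pbwVec R 0 j k)) =
      linOp (c g 1) (pbwY c τ) (pbwG c τ g (pbwVec R 0 j k)) := by
  rw [pbwY_vec_zero, pbwG_vec, pbwG_vec, pow_succ', pow_zero, Module.End.mul_apply,
    Module.End.one_apply, Module.End.one_apply]

variable (hmul : ∀ g h, c (g * h) = c h * c g) (hone : c 1 = 1) (hdet : ∀ g, (c g).det = 1)
  (hτ : ∀ g h, τ (g * h) = τ (h * g))

include hone in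
lemma pbwG_one : pbwG c τ 1 = 1 := by
  have hY : ∀ j k, (pbwY c τ ^ j) (pbwVec R 0 0 k) = pbwVec R 0 j k := by
    intro j k
    induction j with
    | zero => simp
    | succ j ih => rw [pow_succ', Module.End.mul_apply, ih, pbwY_vec_zero]
  have hX : ∀ i j (k : G), (pbwX R G ^ i) (pbwVec R 0 j k) = pbwVec R i j k := by
    intro i j k
    induction i with
    | zero => simp
    | succ i ih => rw [pow_succ', Module.End.mul_apply, ih, pbwX_vec]
  have h0 : linOp (c 1 0) (pbwY c τ) = pbwX R G := by simp [linOp, hone]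
  have h1 : linOp (c 1 1) (pbwY c τ) = pbwY c τ := by simp [linOp, hone]
  refine pbw_ext fun i j k => ?_
  rw [pbwG_vec, h0, h1, one_mul, hY, hX]; rfl

-- The commutator of two linear forms is the determinant of their coefficients times that of `x` and
-- `y`. Determinant one thus makes the left side of the defining relation `G`-invariant.
include hdet in
lemma linOp_comm (g : G) : linOp (c g 0) (pbwY c τ) * linOp (c g 1) (pbwY c τ) -
    linOp (c g 1) (pbwY c τ) * linOp (c g 0) (pbwY c τ) = ∑ g, τ g • pbwG c τ g := by
  rw [← pbw_comm c τ, ← one_smul R (pbwX R G * pbwY c τ - pbwY c τ * pbwX R G), ← hdet g,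
    Matrix.det_fin_two]
  simp only [linOp, add_mul, mul_add, smul_mul_smul_comm]
  module

include hmul hdet hτ

/-- The two relations need each other, hence the joint induction on degree. Moving `g` past `y x = x
y - τ` uses multiplicativity on the `τ`-term, while multiplicativity on `y w` or `x w` uses that `g`
passes `y` in lower degree. -/
lemma pbwG_low (n : ℕ) :
    (∀ g, ∀ m ∈ pbwLow R G n, pbwG c τ g (pbwY c τ m) =
      linOp (c g 1) (pbwY c τ) (pbwG c τ g m)) ∧
    (∀ g h, ∀ m ∈ pbwLow R G n, pbwG c τ g (pbwG c τ h m) = pbwG c τ (g * h) m) := by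
  induction n with
  | zero =>
    have h0 : ∀ m ∈ pbwLow R G 0, m = 0 := by simp [pbwLow]
    constructor <;> intros <;> simp [h0 _ ‹_›]
  | succ n ih =>
    obtain ⟨ihY, ihG⟩ := ih
    have hlow : ∀ g, ∀ m ∈ pbwLow R G n, pbwG c τ g m ∈ pbwLow R G n :=
      fun g m hm => (isDegOne_pbwY c τ).actOp_mem g hm
    have hX : ∀ g m, pbwG c τ g (pbwX R G m) = linOp (c g 0) (pbwY c τ) (pbwG c τ g m) :=
      fun g m => LinearMap.congr_fun (pbwG_mul_pbwX c τ g) m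
    have hxy : ∀ m, pbwY c τ (pbwX R G m) =
        pbwX R G (pbwY c τ m) - ∑ h, τ h • pbwG c τ h m := by
      intro m
      have := LinearMap.congr_fun (pbw_comm c τ) m
      simp only [LinearMap.sub_apply, Module.End.mul_apply, LinearMap.sum_apply,
        LinearMap.smul_apply] at this
      rw [← this]; abel
    have hlin : ∀ g m, linOp (c g 1) (pbwY c τ) (linOp (c g 0) (pbwY c τ) m) =
        linOp (c g 0) (pbwY c τ) (linOp (c g 1) (pbwY c τ) m) -
          ∑ h, τ h • pbwG c τ h m := by
      intro g m
      have := LinearMap.congr_fun (linOp_comm c τ hdet g) m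
      simp only [LinearMap.sub_apply, Module.End.mul_apply, LinearMap.sum_apply,
        LinearMap.smul_apply] at this
      rw [← this]; abel
    -- The trace-like property of `τ` lets the sum be reindexed by conjugation with `g`.
    have hcent : ∀ g, ∀ m ∈ pbwLow R G n,
        pbwG c τ g (∑ h, τ h • pbwG c τ h m) = ∑ h, τ h • pbwG c τ h (pbwG c τ g m) := by
      intro g m hm
      simp only [map_sum, map_smul, ihG _ _ m hm]
      refine Fintype.sum_equiv (MulAut.conj g).toEquiv _ _ fun h => ?_
      have : τ (g * h * g⁻¹) = τ h := by rw [hτ, inv_mul_cancel_left]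
      simp [this]
    have hprod : ∀ g h : G, ∀ m ∈ pbwLow R G n, ∀ i,
        pbwG c τ g (linOp (c h i) (pbwY c τ) (pbwG c τ h m)) =
          linOp (c (g * h) i) (pbwY c τ) (pbwG c τ (g * h) m) := by
      intro g h m hm i
      rw [linOp_apply, map_add, map_smul, map_smul, hX, ihY _ _ (hlow h m hm), ihG _ _ m hm]
      simp only [linOp_apply, hmul, Matrix.mul_apply, Fin.sum_univ_two]
      module
    constructor
    · intro g m hm
      refine pbwLow_ext (f := pbwG c τ g * pbwY c τ)
        (g := linOp (c g 1) (pbwY c τ) * pbwG c τ g) (fun i j k hij => ?_) hm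
      rw [Module.End.mul_apply, Module.End.mul_apply]
      cases i with
      | zero => exact pbwG_pbwY_vec_zero c τ g j k
      | succ i =>
        have hm : pbwVec R i j k ∈ pbwLow R G n := pbwVec_mem_low (by omega)
        rw [← pbwX_vec, hxy, map_sub, hX, hX, ihY _ _ hm, hlin, hcent _ _ hm]
    · intro g h m hm
      refine pbwLow_ext (f := pbwG c τ g * pbwG c τ h) (g := pbwG c τ (g * h))
        (fun i j k hij => ?_) hm
      rw [Module.End.mul_apply]
      cases i with
      | zero =>
        cases j with
        | zero => simp [pbwG_vec, mul_assoc]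
        | succ j =>
          have hm : pbwVec R 0 j k ∈ pbwLow R G n := pbwVec_mem_low (by omega)
          rw [← pbwY_vec_zero c τ, pbwG_pbwY_vec_zero, pbwG_pbwY_vec_zero, hprod _ _ _ hm]
      | succ i =>
        have hm : pbwVec R i j k ∈ pbwLow R G n := pbwVec_mem_low (by omega)
        rw [← pbwX_vec, hX, hX, hprod _ _ _ hm]

lemma pbwG_mul_pbwY (g : G) :
    pbwG c τ g * pbwY c τ = linOp (c g 1) (pbwY c τ) * pbwG c τ g :=
  pbw_ext fun i j _ => (pbwG_low c τ hmul hdet hτ (i + j + 1)).1 g _ (pbwVec_mem_low (by omega))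

lemma pbwG_mul (g h : G) : pbwG c τ (g * h) = pbwG c τ g * pbwG c τ h :=
  pbw_ext fun i j _ =>
    ((pbwG_low c τ hmul hdet hτ (i + j + 1)).2 g h _ (pbwVec_mem_low (by omega))).symm

end PBW

/-! ### Leading forms dehomogenised to one-variable polynomials, and regularity of `x^N`, `y^N` -/

lemma natDegree_X_pow_mul_le {W : Type*} [CommRing W] {n : ℕ} {P : W[X]} (hP : P.natDegree ≤ n)
    (k : ℕ) : (X ^ k * P).natDegree ≤ n + k :=
  natDegree_mul_le.trans (by have := natDegree_X_pow_le (R := W) k; omega)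

section LeadingForms

variable {R A W : Type*} [CommRing R] [Ring A] [Algebra R A] [CommRing W]

/-- A parametrization of the leading forms of degree `n` of a filtered algebra by the polynomials
of degree at most `n`, for which left multiplication by `x` is multiplication by the variable and
left multiplication by `y` is the identity. -/
structure IsLeadingForms (F : ℤ → Submodule R A) (x y : A) (β : ℕ → W[X] →+ A) : Prop where
  mono : Monotone F
  mul_mem : ∀ {m n a b}, a ∈ F m → b ∈ F n → a * b ∈ F (m + n)
  eq_bot : ∀ n, n < 0 → F n = ⊥
  exists_mem : ∀ a, ∃ n, a ∈ F n
  left_mem : x ∈ F 1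
  right_mem : y ∈ F 1
  one_mem : 1 ∈ F 0
  mem : ∀ (n : ℕ) P, P.natDegree ≤ n → β n P ∈ F n
  surj : ∀ (n : ℕ), ∀ s ∈ F n, ∃ P, P.natDegree ≤ n ∧ s - β n P ∈ F (n - 1)
  inj : ∀ (n : ℕ) P, P.natDegree ≤ n → β n P ∈ F (n - 1) → P = 0
  left_mul : ∀ (n : ℕ) P, P.natDegree ≤ n → x * β n P - β (n + 1) (X * P) ∈ F n
  right_mul : ∀ (n : ℕ) P, P.natDegree ≤ n → y * β n P - β (n + 1) P ∈ F n

namespace IsLeadingForms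

variable {F : ℤ → Submodule R A} {x y : A} {β : ℕ → W[X] →+ A} (h : IsLeadingForms F x y β)
include h

lemma mul_mem' {m n k : ℤ} {a b : A} (ha : a ∈ F m) (hb : b ∈ F n) (hk : m + n ≤ k) :
    a * b ∈ F k :=
  h.mono hk (h.mul_mem ha hb)

lemma eq_zero_of_neg {a : A} {n : ℤ} (hn : n < 0) (ha : a ∈ F n) : a = 0 := by
  rw [h.eq_bot n hn] at ha; simpa using ha

lemma pow_mem {a : A} (ha : a ∈ F 1) (k : ℕ) : a ^ k ∈ F k := by
  induction k with
  | zero => simpa using h.one_mem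
  | succ k ih => rw [pow_succ]; exact h.mul_mem' ih ha (by push_cast; omega)

lemma left_pow_mul {n : ℕ} {P : W[X]} (hP : P.natDegree ≤ n) (k : ℕ) :
    x ^ k * β n P - β (n + k) (X ^ k * P) ∈ F (n + k - 1) := by
  induction k with
  | zero => simp
  | succ k ih =>
    have h1 := h.left_mul (n + k) (X ^ k * P) (natDegree_X_pow_mul_le hP k)
    have h2 := h.mul_mem' h.left_mem ih (k := n + k) (by omega)
    have : x ^ (k + 1) * β n P - β (n + (k + 1)) (X ^ (k + 1) * P) =
        x * (x ^ k * β n P - β (n + k) (X ^ k * P)) +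
          (x * β (n + k) (X ^ k * P) - β (n + k + 1) (X * (X ^ k * P))) := by
      rw [pow_succ', pow_succ', mul_assoc X, ← add_assoc]; noncomm_ring
    rw [this]
    exact h.mono (by push_cast; omega) (add_mem h2 (h.mono (by push_cast; omega) h1))

lemma right_pow_mul {n : ℕ} {P : W[X]} (hP : P.natDegree ≤ n) (k : ℕ) :
    y ^ k * β n P - β (n + k) P ∈ F (n + k - 1) := by
  induction k with
  | zero => simp
  | succ k ih =>
    have h1 := h.right_mul (n + k) P (by omega)
    have h2 := h.mul_mem' h.right_mem ih (k := n + k) (by omega)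
    have : y ^ (k + 1) * β n P - β (n + (k + 1)) P =
        y * (y ^ k * β n P - β (n + k) P) + (y * β (n + k) P - β (n + k + 1) P) := by
      rw [pow_succ', ← add_assoc]; noncomm_ring
    rw [this]
    exact h.mono (by push_cast; omega) (add_mem h2 (h.mono (by push_cast; omega) h1))

variable {p q : A} {N : ℕ} (hp : p - x ^ N ∈ F (N - 1)) (hq : q - y ^ N ∈ F (N - 1))

include hp in
lemma left_mul_sub_mem {n : ℕ} {P : W[X]} (hP : P.natDegree ≤ n) :
    p * β n P - β (n + N) (X ^ N * P) ∈ F (n + N - 1) := by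
  have h1 := h.left_pow_mul hP N
  have h2 := h.mul_mem' hp (h.mem n P hP) (k := n + N - 1) (by omega)
  have : p * β n P - β (n + N) (X ^ N * P) = (p - x ^ N) * β n P +
      (x ^ N * β n P - β (n + N) (X ^ N * P)) := by noncomm_ring
  rw [this]; exact add_mem h2 h1

include hq in
lemma right_mul_sub_mem {n : ℕ} {P : W[X]} (hP : P.natDegree ≤ n) :
    q * β n P - β (n + N) P ∈ F (n + N - 1) := by
  have h1 := h.right_pow_mul hP N
  have h2 := h.mul_mem' hq (h.mem n P hP) (k := n + N - 1) (by omega)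
  have : q * β n P - β (n + N) P = (q - y ^ N) * β n P +
      (y ^ N * β n P - β (n + N) P) := by noncomm_ring
  rw [this]; exact add_mem h2 h1

include hp in
lemma left_elem_mem : p ∈ F N := by
  have := add_mem (h.mono (by omega) hp) (h.pow_mem h.left_mem N)
  rwa [sub_add_cancel] at this

include hq in
lemma right_elem_mem : q ∈ F N := by
  have := add_mem (h.mono (by omega) hq) (h.pow_mem h.right_mem N)
  rwa [sub_add_cancel] at this

-- On leading forms `p` acts as `X ^ N`, which is monic and so kills no nonzero polynomial. Hence
-- the leading form of `a` vanishes in each degree above `n`, and the degree of `a` descends to `n`.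
include hp in
lemma mem_of_mul_left (a : A) (n : ℤ) (ha : p * a ∈ F (n + N)) : a ∈ F n := by
  obtain ⟨k, hk⟩ := h.exists_mem a
  have key : ∀ j : ℕ, a ∈ F (n + j) → a ∈ F n := by
    intro j
    induction j with
    | zero => simp
    | succ j ih =>
      intro hj
      refine ih ?_
      rcases lt_or_ge (n + (j + 1 : ℕ)) 0 with hneg | hneg
      · rw [h.eq_zero_of_neg hneg hj]; exact zero_mem _
      obtain ⟨d, hd⟩ := Int.eq_ofNat_of_zero_le hneg
      rw [hd] at hj
      obtain ⟨P, hP, hPa⟩ := h.surj d a hj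
      have h1 := h.left_mul_sub_mem hp hP
      have h2 := h.mul_mem' (h.left_elem_mem hp) hPa (k := d + N - 1) (by omega)
      have h3 : β (d + N) (X ^ N * P) ∈ F ((d + N : ℕ) - 1) := by
        have := sub_mem (sub_mem (h.mono (by push_cast at hd; omega) ha) h2) h1
        convert this using 1
        · push_cast; rfl
        · noncomm_ring
      have h4 := h.inj _ _ (natDegree_X_pow_mul_le hP N) h3
      have h5 : P = 0 := by
        rw [mul_comm] at h4
        exact ((monic_X_pow N).mul_left_eq_zero_iff).1 h4
      rw [h5, map_zero, sub_zero] at hPa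
      exact h.mono (by push_cast at hd; omega) hPa
  exact key (k - n).toNat (h.mono (by omega) hk)

-- On leading forms `q` acts as the identity, so the hypothesis reads `P = X ^ N * Q`. Then `Q` has
-- degree at most `n - N`, so it is also a form of degree `n - N`, and that form is the common
-- quotient `m`.
include hp hq in
lemma div_left [Nontrivial W] (a b : A) (n : ℤ) (ha : a ∈ F n) (hb : b ∈ F n)
    (hab : q * a - p * b ∈ F (n + N - 1)) :
    ∃ m ∈ F (n - N), a - p * m ∈ F (n - 1) ∧ b - q * m ∈ F (n - 1) := by
  rcases lt_or_ge n 0 with hneg | hneg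
  · rw [h.eq_zero_of_neg hneg ha, h.eq_zero_of_neg hneg hb]
    exact ⟨0, zero_mem _, by simp, by simp⟩
  obtain ⟨n, rfl⟩ := Int.eq_ofNat_of_zero_le hneg
  obtain ⟨P, hP, hPa⟩ := h.surj n a ha
  obtain ⟨Q, hQ, hQb⟩ := h.surj n b hb
  have h1 := h.right_mul_sub_mem hq hP
  have h2 := h.left_mul_sub_mem hp hQ
  have h3 := h.mul_mem' (h.right_elem_mem hq) hPa (k := n + N - 1) (by omega)
  have h4 := h.mul_mem' (h.left_elem_mem hp) hQb (k := n + N - 1) (by omega)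
  have h5 : β (n + N) (P - X ^ N * Q) ∈ F ((n + N : ℕ) - 1) := by
    have := sub_mem (add_mem (sub_mem hab h3) (add_mem h4 h2)) h1
    convert this using 1
    · push_cast; rfl
    · rw [map_sub]; noncomm_ring
  have h6 : P = X ^ N * Q := sub_eq_zero.1 (h.inj _ _
    ((natDegree_sub_le _ _).trans (max_le (by omega) (natDegree_X_pow_mul_le hQ N))) h5)
  -- For `Q = 0` the degree count says nothing and `n` may be less than `N`; both leading forms
  -- vanish and `m = 0` works.
  by_cases hQ0 : Q = 0
  · subst hQ0
    rw [mul_zero] at h6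
    subst h6
    rw [map_zero, sub_zero] at hPa hQb
    exact ⟨0, zero_mem _, by simpa using hPa, by simpa using hQb⟩
  have hdeg : P.natDegree = N + Q.natDegree := by
    rw [h6, (monic_X_pow N).natDegree_mul' hQ0, natDegree_X_pow]
  obtain ⟨k, rfl⟩ : ∃ k, n = k + N := ⟨n - N, by omega⟩
  have hQk : Q.natDegree ≤ k := by omega
  refine ⟨β k Q, h.mono (by push_cast; omega) (h.mem k Q hQk), ?_, ?_⟩
  · have := sub_mem hPa (h.mono (by push_cast; omega) (h.left_mul_sub_mem hp hQk))
    rw [← h6] at this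
    convert this using 1
    noncomm_ring
  · have := sub_mem hQb (h.mono (by push_cast; omega) (h.right_mul_sub_mem hq hQk))
    convert this using 1
    noncomm_ring

-- Division by `X ^ N`: the quotient is the coefficient of `p` and the remainder that of `q`. The
-- remainder has degree at most `N - 1`, and `2N - 1 ≤ n` is what makes it fit into degree `n - N`.
include hp hq in
lemma decomp_left [Nontrivial W] (s : A) (n : ℤ) (hn : 2 * (N : ℤ) - 1 ≤ n) (hs : s ∈ F n) :
    ∃ c ∈ F (n - N), ∃ c' ∈ F (n - N), s - (p * c + q * c') ∈ F (n - 1) := by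
  rcases lt_or_ge n 0 with hneg | hneg
  · rw [h.eq_zero_of_neg hneg hs]
    exact ⟨0, zero_mem _, 0, zero_mem _, by simp⟩
  obtain ⟨n, rfl⟩ := Int.eq_ofNat_of_zero_le hneg
  obtain ⟨k, rfl⟩ : ∃ k, n = k + N := ⟨n - N, by omega⟩
  obtain ⟨P, hP, hPs⟩ := h.surj _ s hs
  have hX : (X ^ N : W[X]).Monic := monic_X_pow N
  have hU : (P /ₘ X ^ N).natDegree ≤ k := by
    rw [natDegree_divByMonic _ hX, natDegree_X_pow]; omega
  have hV : (P %ₘ X ^ N).natDegree ≤ k := by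
    rcases Nat.eq_zero_or_pos N with rfl | hN
    · simp
    · have := natDegree_modByMonic_lt P hX (by
        intro h1
        have := congrArg natDegree h1
        rw [natDegree_X_pow, natDegree_one] at this
        omega)
      rw [natDegree_X_pow] at this
      omega
  refine ⟨_, h.mono (by push_cast; omega) (h.mem k _ hU), _,
    h.mono (by push_cast; omega) (h.mem k _ hV), ?_⟩
  have h1 := h.left_mul_sub_mem hp hU
  have h2 := h.right_mul_sub_mem hq hV
  have h3 := sub_mem (sub_mem hPs (h.mono (by push_cast; omega) h1))
    (h.mono (by push_cast; omega) h2)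
  convert h3 using 1
  have : β (k + N) P = β (k + N) (X ^ N * (P /ₘ X ^ N)) + β (k + N) (P %ₘ X ^ N) := by
    rw [← map_add, add_comm (X ^ N * _), modByMonic_add_div P]
  rw [this]
  noncomm_ring

end IsLeadingForms

/-- The filtered pairs obtained from leading forms on both sides. -/
theorem isFilteredPair_of_leadingForms [Nontrivial W] {F : ℤ → Submodule R A} {x y : A}
    {β β' : ℕ → W[X] →+ A} (h : IsLeadingForms F x y β)
    (h' : IsLeadingForms (fun n => (F n).map (opLinearEquiv R : A ≃ₗ[R] Aᵐᵒᵖ).toLinearMap)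
      (op x) (op y) (fun n => opAddEquiv.toAddMonoidHom.comp (β' n)))
    (hfg : ∀ n, (F n).FG) {p q : A} {N : ℕ}
    (hp : p - x ^ N ∈ F (N - 1)) (hq : q - y ^ N ∈ F (N - 1))
    (hpq : p * q - q * p ∈ F (2 * N - 1)) : IsFilteredPair F p q N := by
  have key : ∀ n (a : Aᵐᵒᵖ),
      a ∈ (F n).map (opLinearEquiv R : A ≃ₗ[R] Aᵐᵒᵖ).toLinearMap ↔ unop a ∈ F n := by
    intro n a
    constructor
    · rintro ⟨b, hb, rfl⟩; exact hb
    · intro ha; exact ⟨unop a, ha, rfl⟩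
  have hp' := (key (N - 1) (op p - op x ^ N)).2 hp
  have hq' := (key (N - 1) (op q - op y ^ N)).2 hq
  refine ⟨h.mono, h.mul_mem, h.eq_bot, h.exists_mem, hfg, by positivity, h.left_elem_mem hp,
    h.right_elem_mem hq, hpq, fun a n ha => ?_, h.mem_of_mul_left hp, fun a b n ha hb hab => ?_,
    h.div_left hp hq, h.decomp_left hp hq, fun s n hn hs => ?_⟩
  · exact (key n (op a)).1 (h'.mem_of_mul_left hp' (op a) n ((key _ _).2 ha))
  · obtain ⟨m, hm, h1, h2⟩ := h'.div_left hp' hq' (op a) (op b) n ((key _ _).2 ha)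
      ((key _ _).2 hb) ((key _ _).2 hab)
    exact ⟨unop m, (key _ _).1 hm, (key _ _).1 h1, (key _ _).1 h2⟩
  · obtain ⟨c, hc, c', hc', h1⟩ := h'.decomp_left hp' hq' (op s) n hn ((key _ _).2 hs)
    exact ⟨unop c, (key _ _).1 hc, unop c', (key _ _).1 hc', (key _ _).1 h1⟩

end LeadingForms

/-! ### The degree filtration of a PBW algebra -/

section PBWAlgebra

variable {R G A : Type*} [CommRing R] [Group G] [Ring A] [Algebra R A]

/-- An algebra generated by two elements `v 0`, `v 1` and a copy of the group `G` which acts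
linearly on the `v i`, with commutator `v 0 * v 1 - v 1 * v 0 = ∑ g, τ g • g`, in which the ordered
monomials `v 0 ^ i * v 1 ^ j * g` are sent by a linear map `Θ` to a basis. -/
structure IsPBWAlgebra [Fintype G] (c : G → Matrix (Fin 2) (Fin 2) R) (τ : G → R) (v : Fin 2 → A)
    (γ : G →* A) (Θ : A →ₗ[R] PBWModule R G) : Prop where
  map_mul : ∀ g h, c (g * h) = c h * c g
  map_one : c 1 = 1
  skew : ∀ g i, γ g * v i = (∑ j, c g i j • v j) * γ g
  comm : v 0 * v 1 - v 1 * v 0 = ∑ g, τ g • γ g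
  adjoin : Algebra.adjoin R (Set.range v ∪ Set.range γ) = ⊤
  coord : ∀ i j g, Θ (v 0 ^ i * v 1 ^ j * γ g) = pbwVec R i j g

/-- The span of the ordered monomials `v 0 ^ i * v 1 ^ j * γ g` of degree `i + j ≤ n`. -/
def monFil (R : Type*) {G A : Type*} [CommRing R] [Group G] [Ring A] [Algebra R A]
    (v : Fin 2 → A) (γ : G →* A) (n : ℤ) : Submodule R A :=
  Submodule.span R
    ((fun t : ℕ × ℕ × G => v 0 ^ t.1 * v 1 ^ t.2.1 * γ t.2.2) '' {t | (t.1 + t.2.1 : ℤ) ≤ n})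

/-- The linear form with coefficients `a`. -/
def linForm (v : Fin 2 → A) (a : Fin 2 → R) : A := ∑ j, a j • v j

section Filtration

variable {v : Fin 2 → A} {γ : G →* A}

lemma monomial_mem {i j : ℕ} {n : ℤ} (h : (i + j : ℤ) ≤ n) (g : G) :
    v 0 ^ i * v 1 ^ j * γ g ∈ monFil R v γ n :=
  Submodule.subset_span ⟨(i, j, g), h, rfl⟩

lemma monFil_mono : Monotone (monFil R v γ) := fun _ _ h =>
  Submodule.span_mono (Set.image_mono fun _ ht => le_trans ht h)

lemma monFil_eq_bot (n : ℤ) (hn : n < 0) : monFil R v γ n = ⊥ := by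
  have : {t : ℕ × ℕ × G | (t.1 + t.2.1 : ℤ) ≤ n} = ∅ := by
    ext t; simp only [Set.mem_ofPred_eq, Set.mem_empty_iff_false, iff_false]; omega
  rw [monFil, this, Set.image_empty, Submodule.span_empty]

lemma monFil_fg [Finite G] (n : ℤ) : (monFil R v γ n).FG := by
  refine Submodule.fg_span (Set.Finite.image _ ?_)
  refine Set.Finite.subset ((Set.finite_Iic n.toNat).prod
    ((Set.finite_Iic n.toNat).prod Set.finite_univ)) fun t ht => ?_
  simp only [Set.mem_ofPred_eq] at ht
  simp only [Set.mem_prod, Set.mem_Iic, Set.mem_univ, and_true]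
  omega

lemma monFil_induction {n : ℤ} {W : Submodule R A}
    (h : ∀ (i j : ℕ) (g : G), (i + j : ℤ) ≤ n → v 0 ^ i * v 1 ^ j * γ g ∈ W) :
    monFil R v γ n ≤ W := by
  rw [monFil, Submodule.span_le]
  rintro _ ⟨⟨i, j, g⟩, hij, rfl⟩
  exact h i j g hij

lemma mul_monFil_mem {a : A} {n : ℤ} {W : Submodule R A}
    (h : ∀ (i j : ℕ) (g : G), (i + j : ℤ) ≤ n → a * (v 0 ^ i * v 1 ^ j * γ g) ∈ W)
    {s : A} (hs : s ∈ monFil R v γ n) : a * s ∈ W :=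
  monFil_induction (W := W.comap (LinearMap.mulLeft R a)) h hs

lemma zero_mul_mem {n : ℤ} {s : A} (hs : s ∈ monFil R v γ n) :
    v 0 * s ∈ monFil R v γ (n + 1) := by
  refine mul_monFil_mem (fun i j g h => ?_) hs
  rw [← mul_assoc, ← mul_assoc, ← pow_succ']
  exact monomial_mem (by push_cast; omega) g

end Filtration

namespace IsPBWAlgebra

variable [Fintype G] {c : G → Matrix (Fin 2) (Fin 2) R} {τ : G → R} {v : Fin 2 → A} {γ : G →* A}
  {Θ : A →ₗ[R] PBWModule R G} (h : IsPBWAlgebra c τ v γ Θ)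
include h

/-- Straightening, for `y` and the group simultaneously: moving `y` past `x` creates group elements,
and moving a group element past a variable creates `y`, in both cases in front of a shorter
monomial. -/
lemma generators_mul_mem_nat (n : ℕ) : ∀ s ∈ monFil R v γ n,
    v 1 * s ∈ monFil R v γ (n + 1) ∧ ∀ g, γ g * s ∈ monFil R v γ n := by
  have hlin : ∀ g m w,
      γ g * (v m * w) = c g m 0 • (v 0 * (γ g * w)) + c g m 1 • (v 1 * (γ g * w)) := by
    intro g m w
    rw [← mul_assoc, h.skew, Fin.sum_univ_two]
    simp only [add_mul, smul_mul_assoc, mul_assoc]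
  induction n with
  | zero =>
    refine fun s hs => ⟨mul_monFil_mem (fun i j g hij => ?_) hs,
      fun g => mul_monFil_mem (fun i j k hij => ?_) hs⟩ <;>
    obtain ⟨rfl, rfl⟩ : i = 0 ∧ j = 0 := by push_cast at hij; omega
    · simpa using monomial_mem (R := R) (v := v) (γ := γ) (i := 0) (j := 1) (n := 1)
        (by norm_num) g
    · simpa using monomial_mem (R := R) (v := v) (γ := γ) (i := 0) (j := 0) (n := 0)
        (by norm_num) (g * k)
  | succ n ih =>
    have hlin' : ∀ g m w, w ∈ monFil R v γ n → γ g * (v m * w) ∈ monFil R v γ (n + 1) := by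
      intro g m w hw
      rw [hlin]
      have h1 := (ih w hw).2 g
      exact add_mem (Submodule.smul_mem _ _ (zero_mul_mem h1))
        (Submodule.smul_mem _ _ (ih _ h1).1)
    refine fun s hs => ⟨mul_monFil_mem (fun i j g hij => ?_) hs,
      fun g => mul_monFil_mem (fun i j k hij => ?_) hs⟩
    · cases i with
      | zero =>
        rw [pow_zero, one_mul, ← mul_assoc, ← pow_succ']
        simpa using monomial_mem (R := R) (v := v) (γ := γ) (i := 0) (j := j + 1)
          (n := (n + 1 : ℕ) + 1) (by push_cast at hij ⊢; omega) g
      | succ i =>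
        have hw := monomial_mem (R := R) (v := v) (γ := γ) (i := i) (j := j) (n := n)
          (by push_cast at hij; omega) g
        have : v 1 * (v 0 ^ (i + 1) * v 1 ^ j * γ g) =
            v 0 * (v 1 * (v 0 ^ i * v 1 ^ j * γ g)) -
              (∑ g, τ g • γ g) * (v 0 ^ i * v 1 ^ j * γ g) := by
          rw [← h.comm, pow_succ']; noncomm_ring
        rw [this]
        refine sub_mem ?_ ?_
        · exact_mod_cast zero_mul_mem (ih _ hw).1
        · rw [Finset.sum_mul]
          refine sum_mem fun k _ => ?_
          rw [smul_mul_assoc]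
          exact Submodule.smul_mem _ _ (monFil_mono (by push_cast; omega) ((ih _ hw).2 k))
    · cases i with
      | zero =>
        cases j with
        | zero =>
          simpa using monomial_mem (R := R) (v := v) (γ := γ) (i := 0) (j := 0)
            (n := (n + 1 : ℕ)) (by push_cast; omega) (g * k)
        | succ j =>
          have hw := monomial_mem (R := R) (v := v) (γ := γ) (i := 0) (j := j) (n := n)
            (by push_cast at hij ⊢; omega) k
          rw [pow_zero, one_mul] at hw ⊢
          rw [pow_succ', mul_assoc (v 1)]
          exact_mod_cast hlin' g 1 _ hw
      | succ i =>
        have hw := monomial_mem (R := R) (v := v) (γ := γ) (i := i) (j := j) (n := n)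
          (by push_cast at hij; omega) k
        rw [pow_succ', mul_assoc (v 0), mul_assoc (v 0)]
        exact_mod_cast hlin' g 0 _ hw

lemma generators_mul_mem {n : ℤ} {s : A} (hs : s ∈ monFil R v γ n) :
    (∀ i, v i * s ∈ monFil R v γ (n + 1)) ∧ ∀ g, γ g * s ∈ monFil R v γ n := by
  rcases lt_or_ge n 0 with hn | hn
  · rw [monFil_eq_bot n hn, Submodule.mem_bot] at hs
    subst hs
    simp
  · obtain ⟨n, rfl⟩ := Int.eq_ofNat_of_zero_le hn
    have := h.generators_mul_mem_nat n s hs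
    exact ⟨fun i => by fin_cases i; exacts [zero_mul_mem hs, this.1], this.2⟩

lemma pow_mul_mem (i k : ℕ) (l : Fin 2) {n : ℤ} {s : A} (hs : s ∈ monFil R v γ n)
    (hk : k = i) : v l ^ i * s ∈ monFil R v γ (k + n) := by
  subst hk
  induction k with
  | zero => simpa using hs
  | succ i ih =>
    rw [pow_succ', mul_assoc]
    exact monFil_mono (by push_cast; omega) ((h.generators_mul_mem ih).1 l)

lemma mul_mem {m n : ℤ} {a b : A} (ha : a ∈ monFil R v γ m) (hb : b ∈ monFil R v γ n) :
    a * b ∈ monFil R v γ (m + n) := by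
  have : monFil R v γ m ≤ (monFil R v γ (m + n)).comap (LinearMap.mulRight R b) := by
    refine monFil_induction fun i j g hij => ?_
    rw [Submodule.mem_comap, LinearMap.mulRight_apply, mul_assoc, mul_assoc]
    exact monFil_mono (by omega) (h.pow_mul_mem i i 0 (h.pow_mul_mem j j 1
      ((h.generators_mul_mem hb).2 g) rfl) rfl)
  exact this ha

omit [Fintype G] h in
lemma one_mem : (1 : A) ∈ monFil R v γ 0 := by
  simpa using monomial_mem (R := R) (v := v) (γ := γ) (i := 0) (j := 0) (n := 0) (by norm_num) 1

omit [Fintype G] h in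
lemma group_mem (g : G) : γ g ∈ monFil R v γ 0 := by
  simpa using monomial_mem (R := R) (v := v) (γ := γ) (i := 0) (j := 0) (n := 0) (by norm_num) g

lemma var_mem (i : Fin 2) : v i ∈ monFil R v γ 1 := by
  simpa using (h.generators_mul_mem one_mem).1 i

lemma var_pow_mem (l : Fin 2) (i : ℕ) : v l ^ i ∈ monFil R v γ i := by
  simpa using h.pow_mul_mem i i l one_mem rfl

lemma mul_mem' {m n k : ℤ} {a b : A} (ha : a ∈ monFil R v γ m) (hb : b ∈ monFil R v γ n)
    (hk : m + n ≤ k) : a * b ∈ monFil R v γ k :=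
  monFil_mono hk (h.mul_mem ha hb)

lemma exists_mem (a : A) : ∃ n, a ∈ monFil R v γ n := by
  have ha : a ∈ Algebra.adjoin R (Set.range v ∪ Set.range γ) := by rw [h.adjoin]; trivial
  induction ha using Algebra.adjoin_induction with
  | mem x hx =>
    rcases hx with ⟨i, rfl⟩ | ⟨g, rfl⟩
    · exact ⟨1, h.var_mem i⟩
    · exact ⟨0, group_mem g⟩
  | algebraMap r =>
    refine ⟨0, ?_⟩
    rw [Algebra.algebraMap_eq_smul_one]
    exact Submodule.smul_mem _ _ one_mem
  | add x y _ _ hx hy =>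
    obtain ⟨m, hm⟩ := hx
    obtain ⟨n, hn⟩ := hy
    exact ⟨max m n, add_mem (monFil_mono (le_max_left _ _) hm)
      (monFil_mono (le_max_right _ _) hn)⟩
  | mul x y _ _ hx hy =>
    obtain ⟨m, hm⟩ := hx
    obtain ⟨n, hn⟩ := hy
    exact ⟨m + n, h.mul_mem hm hn⟩

end IsPBWAlgebra

/-- The elements of degree at most `k` whose commutators with the `v i` have degree at most `k`. -/
def commFil (R : Type*) {G A : Type*} [CommRing R] [Group G] [Ring A] [Algebra R A]
    (v : Fin 2 → A) (γ : G →* A) (k : ℤ) : Submodule R A where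
  carrier := {d | d ∈ monFil R v γ k ∧ ∀ i, v i * d - d * v i ∈ monFil R v γ k}
  zero_mem' := ⟨zero_mem _, fun i => by simp⟩
  add_mem' := fun {a b} ha hb => ⟨add_mem ha.1 hb.1, fun i => by
    have := add_mem (ha.2 i) (hb.2 i)
    convert this using 1; noncomm_ring⟩
  smul_mem' := fun r a ha => ⟨Submodule.smul_mem _ _ ha.1, fun i => by
    have := Submodule.smul_mem _ r (ha.2 i)
    rwa [smul_sub, ← mul_smul_comm, ← smul_mul_assoc] at this⟩

namespace IsPBWAlgebra

variable [Fintype G] {c : G → Matrix (Fin 2) (Fin 2) R} {τ : G → R} {v : Fin 2 → A} {γ : G →* A}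
  {Θ : A →ₗ[R] PBWModule R G} (h : IsPBWAlgebra c τ v γ Θ)
include h

lemma var_comm_mem (i j : Fin 2) : v i * v j - v j * v i ∈ monFil R v γ 0 := by
  have h01 : v 0 * v 1 - v 1 * v 0 ∈ monFil R v γ 0 := by
    rw [h.comm]
    exact sum_mem fun g _ => Submodule.smul_mem _ _ (group_mem g)
  have h10 := neg_mem h01
  rw [neg_sub] at h10
  fin_cases i <;> fin_cases j
  · simp
  · exact h01
  · exact h10
  · simp

omit [Fintype G] h in
lemma one_mem_commFil : (1 : A) ∈ commFil R v γ 0 := ⟨one_mem, fun i => by simp⟩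

lemma mul_var_mem_commFil {d : A} {k : ℤ} (hd : d ∈ commFil R v γ k) (l : Fin 2) :
    d * v l ∈ commFil R v γ (k + 1) := by
  refine ⟨h.mul_mem hd.1 (h.var_mem l), fun i => ?_⟩
  have : v i * (d * v l) - d * v l * v i =
      (v i * d - d * v i) * v l + d * (v i * v l - v l * v i) := by noncomm_ring
  rw [this]
  exact add_mem (h.mul_mem (hd.2 i) (h.var_mem l))
    (h.mul_mem' hd.1 (h.var_comm_mem i l) (by omega))

lemma mul_linForm_mem_commFil {d : A} {k : ℤ} (hd : d ∈ commFil R v γ k) (a : Fin 2 → R) :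
    d * linForm v a ∈ commFil R v γ (k + 1) := by
  rw [linForm, Finset.mul_sum]
  refine sum_mem fun j _ => ?_
  rw [mul_smul_comm]
  exact Submodule.smul_mem _ _ (h.mul_var_mem_commFil hd j)

lemma linForm_mem (a : Fin 2 → R) : linForm v a ∈ monFil R v γ 1 :=
  sum_mem fun j _ => Submodule.smul_mem _ _ (h.var_mem j)

lemma var_pow_mem_commFil (l : Fin 2) (i : ℕ) : v l ^ i ∈ commFil R v γ i := by
  induction i with
  | zero => simpa using one_mem_commFil
  | succ i ih => rw [pow_succ]; exact_mod_cast h.mul_var_mem_commFil ih l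

omit [Fintype G] h in
lemma linForm_comm_mem {d : A} {k : ℤ} (hd : d ∈ commFil R v γ k) (a : Fin 2 → R) :
    linForm v a * d - d * linForm v a ∈ monFil R v γ k := by
  rw [linForm, Finset.mul_sum, Finset.sum_mul, ← Finset.sum_sub_distrib]
  refine sum_mem fun j _ => ?_
  rw [smul_mul_assoc, mul_smul_comm, ← smul_sub]
  exact Submodule.smul_mem _ _ (hd.2 j)

lemma pow_comm_mem {d : A} {k : ℤ} (hd : d ∈ commFil R v γ k) (l : Fin 2) (m : ℕ) :
    v l ^ m * d - d * v l ^ m ∈ monFil R v γ (k + m - 1) := by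
  induction m with
  | zero => simp
  | succ m ih =>
    have : v l ^ (m + 1) * d - d * v l ^ (m + 1) =
        v l * (v l ^ m * d - d * v l ^ m) + (v l * d - d * v l) * v l ^ m := by
      rw [pow_succ']; noncomm_ring
    rw [this]
    exact add_mem (h.mul_mem' (h.var_mem l) ih (by push_cast; omega))
      (h.mul_mem' (hd.2 l) (h.var_pow_mem l m) (by push_cast; omega))

/-- Only `v 0 ^ N` and `v 1 ^ N` contribute in degree `2N`, and their commutator loses a degree. -/
lemma commutator_mem {p q : A} {N : ℕ} (hp : p - v 0 ^ N ∈ monFil R v γ (N - 1))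
    (hq : q - v 1 ^ N ∈ monFil R v γ (N - 1)) : p * q - q * p ∈ monFil R v γ (2 * N - 1) := by
  have h0 := h.var_pow_mem 0 N
  have h1 := h.var_pow_mem 1 N
  have hq' : q ∈ monFil R v γ N := by
    have := add_mem (monFil_mono (by omega) hq) h1
    rwa [sub_add_cancel] at this
  have h2 := h.pow_comm_mem (h.var_pow_mem_commFil 1 N) 0 N
  have : p * q - q * p = (v 0 ^ N * v 1 ^ N - v 1 ^ N * v 0 ^ N) +
      ((p - v 0 ^ N) * q - q * (p - v 0 ^ N)) +
      (v 0 ^ N * (q - v 1 ^ N) - (q - v 1 ^ N) * v 0 ^ N) := by noncomm_ring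
  rw [this]
  exact add_mem (add_mem (monFil_mono (by omega) h2)
    (sub_mem (h.mul_mem' hp hq' (by omega)) (h.mul_mem' hq' hp (by omega))))
    (sub_mem (h.mul_mem' h0 hq (by omega)) (h.mul_mem' hq h0 (by omega)))

lemma group_mul_linForm (g : G) (a : Fin 2 → R) :
    γ g * linForm v a = linForm v (Matrix.vecMul a (c g)) * γ g := by
  simp only [linForm, Fin.sum_univ_two, mul_add, mul_smul_comm, h.skew, Matrix.vecMul,
    dotProduct, add_mul, smul_mul_assoc]
  module

lemma linForm_mul_group (g : G) (a : Fin 2 → R) :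
    linForm v a * γ g = γ g * linForm v (Matrix.vecMul a (c g⁻¹)) := by
  rw [h.group_mul_linForm, Matrix.vecMul_vecMul, ← h.map_mul, mul_inv_cancel, h.map_one,
    Matrix.vecMul_one]

end IsPBWAlgebra
end PBWAlgebra

/-! ### Leading forms of a PBW algebra, with the group on either side -/

section LeadingForms

variable {R G A : Type*} [CommRing R] [Group G] [Fintype G] [Ring A] [Algebra R A]

/-- `∑ i ≤ n, ∑ g, u i g • w i g`. -/
def formSum (R : Type*) {G A : Type*} [CommRing R] [Fintype G] [Ring A] [Algebra R A] (n : ℕ)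
    (w : ℕ → G → A) : (Fin (n + 1) → G → R) →ₗ[R] A where
  toFun u := ∑ i, ∑ g, u i g • w i g
  map_add' u u' := by simp [add_smul, Finset.sum_add_distrib]
  map_smul' r u := by simp [mul_smul, Finset.smul_sum]

/-- `∑ i ≤ n, ∑ g, P.coeff i g • w i g`, for a polynomial `P`. -/
def polySum (R : Type*) {G A : Type*} [CommRing R] [Fintype G] [Ring A] [Algebra R A] (n : ℕ)
    (w : ℕ → G → A) : (G → R)[X] →ₗ[R] A where
  toFun P := ∑ i ∈ Finset.range (n + 1), ∑ g, P.coeff i g • w i g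
  map_add' u u' := by simp [add_smul, Finset.sum_add_distrib]
  map_smul' r u := by simp [mul_smul, Finset.smul_sum]

omit [Group G] in
lemma polySum_apply (n : ℕ) (w : ℕ → G → A) (P : (G → R)[X]) :
    polySum R n w P = ∑ i ∈ Finset.range (n + 1), ∑ g, P.coeff i g • w i g := rfl

omit [Group G] in
lemma polySum_eq_formSum (n : ℕ) (w : ℕ → G → A) (P : (G → R)[X]) :
    polySum R n w P = formSum R n w fun i => P.coeff i :=
  Finset.sum_range fun i => ∑ g, P.coeff i g • w i g

omit [Group G] in
lemma polySum_monomial [DecidableEq G] {n i : ℕ} (hi : i ≤ n) (w : ℕ → G → A) (g : G) :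
    polySum R n w (monomial i (Pi.single g 1)) = w i g := by
  rw [polySum_apply, Finset.sum_eq_single i]
  · rw [Finset.sum_eq_single g]
    · simp
    · intro k _ hk; simp [hk]
    · simp
  · intro j _ hj
    simp [coeff_monomial, Ne.symm hj]
  · intro hi'; exact absurd (Finset.mem_range.2 (by omega)) hi'

/-- The elements which coincide with some `∑ i ≤ n, ∑ g, u i g • w i g` up to terms in `F`. -/
def leadingSub (F : Submodule R A) (n : ℕ) (w : ℕ → G → A) : Submodule R A where
  carrier := {s | ∃ P : (G → R)[X], P.natDegree ≤ n ∧ s - polySum R n w P ∈ F}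
  zero_mem' := ⟨0, by simp, by simp⟩
  add_mem' := by
    rintro a b ⟨P, hP, ha⟩ ⟨Q, hQ, hb⟩
    refine ⟨P + Q, (natDegree_add_le _ _).trans (max_le hP hQ), ?_⟩
    rw [map_add, add_sub_add_comm]
    exact add_mem ha hb
  smul_mem' := by
    rintro r a ⟨P, hP, ha⟩
    refine ⟨r • P, (natDegree_smul_le _ _).trans hP, ?_⟩
    rw [map_smul, ← smul_sub]
    exact Submodule.smul_mem _ _ ha

omit [Group G] in
lemma le_leadingSub (F : Submodule R A) (n : ℕ) (w : ℕ → G → A) : F ≤ leadingSub F n w :=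
  fun s hs => ⟨0, by simp, by simpa using hs⟩

omit [Group G] in
lemma mem_leadingSub (F : Submodule R A) {n i : ℕ} (hi : i ≤ n) (w : ℕ → G → A) (g : G) :
    w i g ∈ leadingSub F n w := by
  classical
  refine ⟨monomial i (Pi.single g 1), (natDegree_monomial_le _).trans hi, ?_⟩
  rw [polySum_monomial hi, sub_self]
  exact zero_mem _

omit [Group G] in
/-- If multiplication by `a` sends `w i g` to `w' (i + 1) g` up to terms in `F`, then it sends the
sum defined by `P` to the one defined by `X * P`. -/
lemma polySum_X_mul (f : A →ₗ[R] A) {F : Submodule R A} {n : ℕ} {w w' : ℕ → G → A}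
    (hw : ∀ i ≤ n, ∀ g, f (w i g) - w' (i + 1) g ∈ F) (P : (G → R)[X]) :
    f (polySum R n w P) - polySum R (n + 1) w' (X * P) ∈ F := by
  have : f (polySum R n w P) - polySum R (n + 1) w' (X * P) =
      ∑ i ∈ Finset.range (n + 1), ∑ g, P.coeff i g • (f (w i g) - w' (i + 1) g) := by
    rw [polySum_apply, polySum_apply, Finset.sum_range_succ' _ (n + 1)]
    simp [map_sum, smul_sub, Finset.sum_sub_distrib, coeff_X_mul]
  rw [this]
  exact sum_mem fun i hi => sum_mem fun g _ => Submodule.smul_mem _ _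
    (hw i (by simpa [Nat.lt_succ_iff] using hi) g)

omit [Group G] in
/-- If multiplication by `a` sends `w i g` to `w' i g` up to terms in `F`, then it sends the sum
defined by `P` to the one defined by `P`. -/
lemma polySum_mul (f : A →ₗ[R] A) {F : Submodule R A} {n : ℕ} {w w' : ℕ → G → A}
    (hw : ∀ i ≤ n, ∀ g, f (w i g) - w' i g ∈ F) {P : (G → R)[X]} (hP : P.natDegree ≤ n) :
    f (polySum R n w P) - polySum R (n + 1) w' P ∈ F := by
  have : f (polySum R n w P) - polySum R (n + 1) w' P =
      ∑ i ∈ Finset.range (n + 1), ∑ g, P.coeff i g • (f (w i g) - w' i g) := by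
    rw [polySum_apply, polySum_apply, Finset.sum_range_succ _ (n + 1),
      coeff_eq_zero_of_natDegree_lt (by omega : P.natDegree < n + 1)]
    simp [map_sum, smul_sub, Finset.sum_sub_distrib]
  rw [this]
  exact sum_mem fun i hi => sum_mem fun g _ => Submodule.smul_mem _ _
    (hw i (by simpa [Nat.lt_succ_iff] using hi) g)

omit [Group G] in
lemma polySum_mem {F : Submodule R A} {n : ℕ} {w : ℕ → G → A} (hw : ∀ i ≤ n, ∀ g, w i g ∈ F)
    (P : (G → R)[X]) : polySum R n w P ∈ F := by
  rw [polySum_apply]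
  exact sum_mem fun i hi => sum_mem fun g _ => Submodule.smul_mem _ _
    (hw i (by simpa [Nat.lt_succ_iff] using hi) g)

/-- The monomials of degree `n` with the group element on the right. -/
def rightMon (v : Fin 2 → A) (γ : G →* A) (n : ℕ) (i : ℕ) (g : G) : A :=
  v 0 ^ i * v 1 ^ (n - i) * γ g

/-- The monomials of degree `n` with the group element on the left. -/
def leftMon (v : Fin 2 → A) (γ : G →* A) (n : ℕ) (i : ℕ) (g : G) : A :=
  γ g * (v 0 ^ i * v 1 ^ (n - i))

lemma group_mul_zero_mul {G A : Type*} [Group G] [Ring A] (v : Fin 2 → A) (γ : G →* A) {n i : ℕ}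
    (g : G) : γ g * (v 0 * (v 0 ^ i * v 1 ^ (n - i))) = leftMon v γ (n + 1) (i + 1) g := by
  rw [leftMon, Nat.add_sub_add_right, pow_succ', mul_assoc (v 0)]

lemma eq_zero_of_coeff {W : Type*} [CommRing W] {n : ℕ} {P : W[X]} (hP : P.natDegree ≤ n)
    (h0 : ∀ i : Fin (n + 1), P.coeff i = 0) : P = 0 := by
  ext1 i
  rcases lt_or_ge i (n + 1) with hi | hi
  · exact h0 ⟨i, hi⟩
  · rw [coeff_eq_zero_of_natDegree_lt (by omega), coeff_zero]

namespace IsPBWAlgebra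

variable {c : G → Matrix (Fin 2) (Fin 2) R} {τ : G → R} {v : Fin 2 → A} {γ : G →* A}
  {Θ : A →ₗ[R] PBWModule R G} (h : IsPBWAlgebra c τ v γ Θ)
include h

lemma coord_eq_zero {n : ℤ} {s : A} (hs : s ∈ monFil R v γ n) {i j : ℕ} (hij : n < i + j)
    (g : G) : Θ s (i, j, g) = 0 := by
  classical
  have : monFil R v γ n ≤ LinearMap.ker ((Finsupp.lapply (i, j, g)).comp Θ) := by
    refine monFil_induction fun i' j' g' h' => ?_
    rw [LinearMap.mem_ker, LinearMap.comp_apply, h.coord, Finsupp.lapply_apply, pbwVec,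
      Finsupp.single_apply, if_neg]
    intro heq
    simp only [Prod.mk.injEq] at heq
    omega
  exact this hs

lemma coord_formSum (n : ℕ) (u : Fin (n + 1) → G → R) (i : Fin (n + 1)) (g : G) :
    Θ (formSum R n (rightMon v γ n) u) ((i : ℕ), n - (i : ℕ), g) = u i g := by
  classical
  change Θ (∑ i, ∑ g, u i g • rightMon v γ n i g) _ = _
  simp only [map_sum, map_smul, rightMon, h.coord, Finsupp.finsetSum_apply, Finsupp.smul_apply,
    pbwVec, smul_eq_mul]
  rw [Finset.sum_eq_single i, Finset.sum_eq_single g]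
  · simp
  · intro k _ hk; rw [Finsupp.single_apply, if_neg (by simpa using hk), mul_zero]
  · simp
  · intro j _ hj
    refine Finset.sum_eq_zero fun k _ => ?_
    rw [Finsupp.single_apply, if_neg, mul_zero]
    intro heq
    simp only [Prod.mk.injEq] at heq
    exact hj (Fin.ext heq.1)
  · simp

omit [Fintype G] h in
lemma rightMon_mem {n i : ℕ} (hi : i ≤ n) (g : G) : rightMon v γ n i g ∈ monFil R v γ n :=
  monomial_mem (by omega) g

lemma leftMon_mem {n i : ℕ} (hi : i ≤ n) (g : G) : leftMon v γ n i g ∈ monFil R v γ n :=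
  h.mul_mem' (group_mem g) (h.mul_mem (h.var_pow_mem 0 i) (h.var_pow_mem 1 (n - i))) (by omega)

omit h in
lemma le_leadingSub_rightMon (n : ℕ) :
    monFil R v γ n ≤ leadingSub (monFil R v γ (n - 1)) n (rightMon v γ n) := by
  refine monFil_induction fun i j g hij => ?_
  rcases hij.lt_or_eq with hlt | heq
  · exact le_leadingSub _ _ _ (monomial_mem (by omega) g)
  · obtain rfl : j = n - i := by omega
    exact mem_leadingSub _ (by omega) (rightMon v γ n) g

lemma leftMon_mul_zero {n i : ℕ} (hi : i ≤ n) (g : G) :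
    leftMon v γ n i g * v 0 - leftMon v γ (n + 1) (i + 1) g ∈ monFil R v γ n := by
  have h1 := neg_mem ((h.var_pow_mem_commFil 1 (n - i)).2 0)
  have : leftMon v γ n i g * v 0 - leftMon v γ (n + 1) (i + 1) g =
      γ g * (v 0 ^ i * -(v 0 * v 1 ^ (n - i) - v 1 ^ (n - i) * v 0)) := by
    rw [leftMon, leftMon, Nat.add_sub_add_right, pow_succ]; noncomm_ring
  rw [this]
  exact h.mul_mem' (group_mem g) (h.mul_mem (h.var_pow_mem 0 i) h1) (by omega)

omit h [Fintype G] in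
lemma leftMon_mul_one {n i : ℕ} (hi : i ≤ n) (g : G) :
    leftMon v γ n i g * v 1 = leftMon v γ (n + 1) i g := by
  rw [leftMon, leftMon, Nat.succ_sub hi, pow_succ]; noncomm_ring

lemma group_mul_one_mul {n i : ℕ} (hi : i ≤ n) (g : G) :
    γ g * (v 1 * (v 0 ^ i * v 1 ^ (n - i))) - leftMon v γ (n + 1) i g ∈ monFil R v γ n := by
  have h1 := (h.var_pow_mem_commFil 0 i).2 1
  have : γ g * (v 1 * (v 0 ^ i * v 1 ^ (n - i))) - leftMon v γ (n + 1) i g =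
      γ g * ((v 1 * v 0 ^ i - v 0 ^ i * v 1) * v 1 ^ (n - i)) := by
    rw [leftMon, Nat.succ_sub hi, pow_succ']; noncomm_ring
  rw [this]
  exact h.mul_mem' (group_mem g) (h.mul_mem h1 (h.var_pow_mem 1 (n - i))) (by omega)

/-- The variable is carried to the right of the group element, where it becomes a linear form, and
then sorted modulo lower degree. Iterating this shows that the left-handed monomials span all
symbols. -/
lemma var_mul_leadingSub (l : Fin 2) (n : ℕ) {s : A}
    (hs : s ∈ leadingSub (monFil R v γ (n - 1)) n (leftMon v γ n)) :
    v l * s ∈ leadingSub (monFil R v γ ((n + 1 : ℕ) - 1)) (n + 1) (leftMon v γ (n + 1)) := by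
  classical
  have hF : (((n + 1 : ℕ) : ℤ) - 1) = n := by push_cast; omega
  rw [hF]
  obtain ⟨P, hP, hs⟩ := hs
  have h1 : v l * (s - polySum R n (leftMon v γ n) P) ∈
      leadingSub (monFil R v γ n) (n + 1) (leftMon v γ (n + 1)) :=
    le_leadingSub _ _ _ (h.mul_mem' (h.var_mem l) hs (by omega))
  have h2 : v l * polySum R n (leftMon v γ n) P ∈
      leadingSub (monFil R v γ n) (n + 1) (leftMon v γ (n + 1)) := by
    refine polySum_mem (F := (leadingSub (monFil R v γ n) (n + 1)
      (leftMon v γ (n + 1))).comap (LinearMap.mulLeft R (v l))) (fun i hi g => ?_) P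
    have hv : v l = linForm v (Pi.single l 1 : Fin 2 → R) := by
      simp [linForm, Pi.single_apply, ite_smul]
    rw [Submodule.mem_comap, LinearMap.mulLeft_apply, leftMon, ← mul_assoc, hv,
      h.linForm_mul_group, mul_assoc, linForm, Fin.sum_univ_two, add_mul, mul_add,
      smul_mul_assoc, smul_mul_assoc, mul_smul_comm, mul_smul_comm, group_mul_zero_mul]
    refine add_mem (Submodule.smul_mem _ _ (mem_leadingSub _ (by omega) _ g))
      (Submodule.smul_mem _ _ ?_)
    have := add_mem (le_leadingSub _ (n + 1) (leftMon v γ (n + 1)) (h.group_mul_one_mul hi g))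
      (mem_leadingSub (monFil R v γ n) (by omega : i ≤ n + 1) (leftMon v γ (n + 1)) g)
    rwa [sub_add_cancel] at this
  have := add_mem h1 h2
  rwa [← mul_add, sub_add_cancel] at this

lemma pow_mul_leadingSub (l : Fin 2) (n k : ℕ) {s : A}
    (hs : s ∈ leadingSub (monFil R v γ (n - 1)) n (leftMon v γ n)) :
    v l ^ k * s ∈ leadingSub (monFil R v γ ((n + k : ℕ) - 1)) (n + k) (leftMon v γ (n + k)) := by
  induction k with
  | zero => simpa using hs
  | succ k ih =>
    rw [pow_succ', mul_assoc]
    exact h.var_mul_leadingSub l (n + k) ih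

lemma le_leadingSub_leftMon (n : ℕ) :
    monFil R v γ n ≤ leadingSub (monFil R v γ (n - 1)) n (leftMon v γ n) := by
  refine monFil_induction fun i j g hij => ?_
  rcases hij.lt_or_eq with hlt | heq
  · exact le_leadingSub _ _ _ (monomial_mem (by omega) g)
  · have h0 : γ g ∈ leadingSub (monFil R v γ ((0 : ℕ) - 1)) 0 (leftMon v γ 0) := by
      have := mem_leadingSub (monFil R v γ ((0 : ℕ) - 1)) (le_refl 0) (leftMon v γ 0) g
      simpa [leftMon] using this
    obtain rfl : n = 0 + j + i := by omega
    rw [mul_assoc]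
    exact h.pow_mul_leadingSub 0 _ i (h.pow_mul_leadingSub 1 0 j h0)

lemma rightMon_inj {n : ℕ} {P : (G → R)[X]} (hP : P.natDegree ≤ n)
    (h0 : polySum R n (rightMon v γ n) P ∈ monFil R v γ (n - 1)) : P = 0 := by
  refine eq_zero_of_coeff hP fun i => funext fun g => ?_
  have := h.coord_formSum n (fun i => P.coeff i) i g
  rw [← polySum_eq_formSum, h.coord_eq_zero h0 (by omega)] at this
  exact this.symm

/-- Let `T` record the right-handed coordinates of left-handed forms. The left-handed monomials span
modulo lower degree, so `T` is surjective; a surjective endomorphism of a finitely generated module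
over a commutative ring is injective. -/
lemma leftMon_inj {n : ℕ} {P : (G → R)[X]} (hP : P.natDegree ≤ n)
    (h0 : polySum R n (leftMon v γ n) P ∈ monFil R v γ (n - 1)) : P = 0 := by
  let T : (Fin (n + 1) → G → R) →ₗ[R] (Fin (n + 1) → G → R) :=
    LinearMap.pi fun i => LinearMap.pi fun g =>
      (Finsupp.lapply ((i : ℕ), n - (i : ℕ), g)).comp (Θ.comp (formSum R n (leftMon v γ n)))
  have hT : ∀ u i g, T u i g = Θ (formSum R n (leftMon v γ n) u) ((i : ℕ), n - (i : ℕ), g) :=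
    fun _ _ _ => rfl
  have hsurj : Function.Surjective T := by
    intro u
    have hu : formSum R n (rightMon v γ n) u ∈ monFil R v γ n := by
      change ∑ i, ∑ g, u i g • rightMon v γ n i g ∈ _
      exact sum_mem fun i _ => sum_mem fun g _ => Submodule.smul_mem _ _
        (rightMon_mem (Nat.lt_succ_iff.1 i.2) g)
    obtain ⟨Q, hQ, hs⟩ := h.le_leadingSub_leftMon n hu
    refine ⟨fun i => Q.coeff i, funext fun i => funext fun g => ?_⟩
    have h1 := h.coord_eq_zero hs (i := i) (j := n - i) (by omega) g
    rw [map_sub, Finsupp.sub_apply, h.coord_formSum, sub_eq_zero, polySum_eq_formSum] at h1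
    rw [hT, h1]
  have hinj := OrzechProperty.injective_of_surjective_endomorphism T hsurj
  refine eq_zero_of_coeff hP fun i => ?_
  have h2 : T (fun i => P.coeff i) = T 0 := by
    rw [map_zero]
    funext i g
    rw [hT, ← polySum_eq_formSum, h.coord_eq_zero h0 (by omega)]
    rfl
  exact congrFun (hinj h2) i

lemma isLeadingForms_left : IsLeadingForms (monFil R v γ) (v 0) (v 1)
    (fun n => (polySum R n (rightMon v γ n)).toAddMonoidHom) where
  mono := monFil_mono
  mul_mem := h.mul_mem
  eq_bot := monFil_eq_bot
  exists_mem := h.exists_mem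
  left_mem := h.var_mem 0
  right_mem := h.var_mem 1
  one_mem := one_mem
  mem n P _ := polySum_mem (fun i hi g => rightMon_mem hi g) P
  surj n s hs := le_leadingSub_rightMon n hs
  inj n P hP h0 := h.rightMon_inj hP h0
  left_mul n P hP := polySum_X_mul (LinearMap.mulLeft R (v 0)) (fun i hi g => by
    have : v 0 * rightMon v γ n i g = rightMon v γ (n + 1) (i + 1) g := by
      rw [rightMon, rightMon, Nat.add_sub_add_right, pow_succ']; noncomm_ring
    rw [LinearMap.mulLeft_apply, this, sub_self]; exact zero_mem _) P
  right_mul n P hP := polySum_mul (LinearMap.mulLeft R (v 1)) (fun i hi g => by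
    have : v 1 * rightMon v γ n i g - rightMon v γ (n + 1) i g =
        (v 1 * v 0 ^ i - v 0 ^ i * v 1) * v 1 ^ (n - i) * γ g := by
      rw [rightMon, rightMon, Nat.succ_sub hi, pow_succ']; noncomm_ring
    rw [LinearMap.mulLeft_apply, this]
    exact h.mul_mem' (h.mul_mem ((h.var_pow_mem_commFil 0 i).2 1) (h.var_pow_mem 1 (n - i)))
      (group_mem g) (by omega)) hP

/-- Right multiplication by a variable acts on exponents without a twist only if the group element
stands on the left, hence the second family of monomials. Here `y` acts exactly and `x` up to lower
degree. -/
lemma isLeadingForms_right : IsLeadingForms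
    (fun n => (monFil R v γ n).map (opLinearEquiv R : A ≃ₗ[R] Aᵐᵒᵖ).toLinearMap)
    (op (v 0)) (op (v 1)) (fun n => opAddEquiv.toAddMonoidHom.comp
      (polySum R n (leftMon v γ n)).toAddMonoidHom) := by
  have key : ∀ n (a : Aᵐᵒᵖ),
      a ∈ (monFil R v γ n).map (opLinearEquiv R : A ≃ₗ[R] Aᵐᵒᵖ).toLinearMap ↔
        unop a ∈ monFil R v γ n := by
    intro n a
    constructor
    · rintro ⟨b, hb, rfl⟩; exact hb
    · intro ha; exact ⟨unop a, ha, rfl⟩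
  exact {
    mono := fun m n hmn a ha => (key _ _).2 (monFil_mono hmn ((key _ _).1 ha))
    mul_mem := fun {m n a b} ha hb => (key _ _).2
      (h.mul_mem' ((key _ _).1 hb) ((key _ _).1 ha) (by omega))
    eq_bot := fun n hn => by rw [monFil_eq_bot n hn, Submodule.map_bot]
    exists_mem := fun a => (h.exists_mem (unop a)).imp fun n hn => (key _ _).2 hn
    left_mem := (key _ _).2 (h.var_mem 0)
    right_mem := (key _ _).2 (h.var_mem 1)
    one_mem := (key _ _).2 one_mem
    mem := fun n P _ => (key _ _).2 (polySum_mem (fun i hi g => h.leftMon_mem hi g) P)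
    surj := fun n s hs => (h.le_leadingSub_leftMon n ((key _ _).1 hs)).imp
      fun P hP => ⟨hP.1, (key _ _).2 hP.2⟩
    inj := fun n P hP h0 => h.leftMon_inj hP ((key _ _).1 h0)
    left_mul := fun n P hP => (key _ _).2 (polySum_X_mul (LinearMap.mulRight R (v 0))
      (fun i hi g => h.leftMon_mul_zero hi g) P)
    right_mul := fun n P hP => (key _ _).2 (polySum_mul (LinearMap.mulRight R (v 1))
      (fun i hi g => by
        rw [LinearMap.mulRight_apply, leftMon_mul_one hi, sub_self]; exact zero_mem _) hP) }

theorem isFilteredPair [Nontrivial R] {p q : A} {N : ℕ} (hp : p - v 0 ^ N ∈ monFil R v γ (N - 1))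
    (hq : q - v 1 ^ N ∈ monFil R v γ (N - 1)) : IsFilteredPair (monFil R v γ) p q N :=
  isFilteredPair_of_leadingForms h.isLeadingForms_left h.isLeadingForms_right monFil_fg hp hq
    (h.commutator_mem hp hq)

end IsPBWAlgebra
end LeadingForms

/-! ### Elements of the trace ideal with symbols `x^N` and `y^N` -/

section TraceIdeal

variable {R G A : Type*} [CommRing R] [Group G] [Fintype G] [Ring A] [Algebra R A]

namespace IsPBWAlgebra

variable {c : G → Matrix (Fin 2) (Fin 2) R} {τ : G → R} {v : Fin 2 → A} {γ : G →* A}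
  {Θ : A →ₗ[R] PBWModule R G} (h : IsPBWAlgebra c τ v γ Θ)
include h

/-- Eliminating the group elements in `Z` from `∑ g, γ g` inside the trace ideal. -/
lemma exists_mem_traceIdeal_of_finset {e : A} (he : ∑ g, γ g ∈ traceIdeal R e)
    (hfree : ∀ g : G, g ≠ 1 → ∀ a : Fin 2 → R, ∃ l, l - Matrix.vecMul l (c g⁻¹) = a)
    (a : Fin 2 → R) (Z : Finset G) (hZ : (1 : G) ∉ Z) :
    ∃ t ∈ traceIdeal R e, ∃ d : G → A, (∀ g, d g ∈ commFil R v γ Z.card) ∧ (∀ g ∈ Z, d g = 0) ∧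
      d 1 = linForm v a ^ Z.card ∧ t - ∑ g, d g * γ g ∈ monFil R v γ (Z.card - 1) := by
  classical
  induction Z using Finset.induction_on with
  | empty =>
    exact ⟨_, he, fun _ => 1, fun _ => one_mem_commFil, by simp, by simp, by simp⟩
  | insert g Z hgZ ih =>
    obtain ⟨t, ht, d, hd, hdZ, hd1, hlow⟩ := ih fun h1 => hZ (Finset.mem_insert_of_mem h1)
    have hg1 : g ≠ 1 := fun h1 => hZ (h1 ▸ Finset.mem_insert_self _ _)
    -- The form `l'` below satisfies `l γ(g) = γ(g) l'`, and `l` is chosen so that `l - l' = a`.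
    obtain ⟨l, hl⟩ := hfree g hg1 a
    set l' := Matrix.vecMul l (c g⁻¹) with hl'
    have hsub : ∀ b b' : Fin 2 → R, linForm v b - linForm v b' = linForm v (b - b') := by
      intro b b'
      simp [linForm, sub_smul]
    -- Modulo lower degree, this twisted commutator multiplies the coefficient of each `k` by the
    -- linear form `l - k·l'`. That form is zero for `k = g` and equals `a` for `k = 1`. Membership
    -- of the coefficients in `commFil` is what lets `l` pass them.
    refine ⟨linForm v l * t - t * linForm v l',
      sub_mem (mul_mem_traceIdeal_left ht _) (mul_mem_traceIdeal_right ht _),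
      fun k => d k * linForm v (l - Matrix.vecMul l' (c k)), fun k => ?_, ?_, ?_, ?_⟩
    · rw [Finset.card_insert_of_notMem hgZ]
      exact_mod_cast h.mul_linForm_mem_commFil (hd k) _
    · intro k hk
      rcases Finset.mem_insert.1 hk with rfl | hk
      · have : Matrix.vecMul l' (c k) = l := by
          rw [hl', Matrix.vecMul_vecMul, ← h.map_mul, mul_inv_cancel, h.map_one,
            Matrix.vecMul_one]
        simp [this, linForm]
      · simp only [hdZ k hk, zero_mul]
    · rw [Finset.card_insert_of_notMem hgZ, pow_succ]
      simp only [h.map_one, Matrix.vecMul_one, hd1, hl]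
    · rw [Finset.card_insert_of_notMem hgZ]
      have key : ∀ k, d k * linForm v (l - Matrix.vecMul l' (c k)) * γ k =
          linForm v l * (d k * γ k) - (d k * γ k) * linForm v l' -
            (linForm v l * d k - d k * linForm v l) * γ k := by
        intro k
        rw [mul_assoc (d k) (γ k), h.group_mul_linForm, ← hsub]
        noncomm_ring
      have : linForm v l * t - t * linForm v l' -
          ∑ k, d k * linForm v (l - Matrix.vecMul l' (c k)) * γ k =
          linForm v l * (t - ∑ g, d g * γ g) - (t - ∑ g, d g * γ g) * linForm v l' +
            ∑ k, (linForm v l * d k - d k * linForm v l) * γ k := by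
        simp only [key, Finset.sum_sub_distrib, mul_sub, sub_mul, Finset.mul_sum, Finset.sum_mul]
        abel
      rw [this]
      refine add_mem (sub_mem (h.mul_mem' (h.linForm_mem l) hlow ?_)
        (h.mul_mem' hlow (h.linForm_mem l') ?_))
        (sum_mem fun k _ => h.mul_mem' (linForm_comm_mem (hd k) l) (group_mem k) ?_) <;>
      push_cast <;> omega

lemma exists_mem_traceIdeal {e : A} (he : ∑ g, γ g ∈ traceIdeal R e)
    (hfree : ∀ g : G, g ≠ 1 → ∀ a : Fin 2 → R, ∃ l, l - Matrix.vecMul l (c g⁻¹) = a)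
    (l : Fin 2) : ∃ p ∈ traceIdeal R e,
      p - v l ^ (Fintype.card G - 1) ∈ monFil R v γ ((Fintype.card G - 1 : ℕ) - 1) := by
  classical
  -- Eliminating all of `G` except `1` takes `|G| - 1` steps, which is the exponent `N`.
  obtain ⟨t, ht, d, -, hdZ, hd1, hlow⟩ := h.exists_mem_traceIdeal_of_finset he hfree
    (Pi.single l 1) (Finset.univ.erase 1) (by simp)
  have hv : linForm v (Pi.single l 1 : Fin 2 → R) = v l := by
    simp [linForm, Pi.single_apply, ite_smul]
  have hsum : ∑ g, d g * γ g = v l ^ (Fintype.card G - 1) := by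
    rw [Finset.sum_eq_single 1 (fun g _ hg => by rw [hdZ g (by simp [hg]), zero_mul]) (by simp),
      hd1, hv, _root_.map_one, mul_one, Finset.card_erase_of_mem (Finset.mem_univ _),
      Finset.card_univ]
  rw [hsum, Finset.card_erase_of_mem (Finset.mem_univ _), Finset.card_univ] at hlow
  exact ⟨t, ht, hlow⟩

theorem exists_isFilteredPair [Nontrivial R] {e : A} (he : ∑ g, γ g ∈ traceIdeal R e)
    (hfree : ∀ g : G, g ≠ 1 → ∀ a : Fin 2 → R, ∃ l, l - Matrix.vecMul l (c g⁻¹) = a) :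
    ∃ p ∈ traceIdeal R e, ∃ q ∈ traceIdeal R e, ∃ N,
      IsFilteredPair (monFil R v γ) p q N := by
  obtain ⟨p, hp, hp'⟩ := h.exists_mem_traceIdeal he hfree 0
  obtain ⟨q, hq, hq'⟩ := h.exists_mem_traceIdeal he hfree 1
  exact ⟨p, hp, q, hq, _, h.isFilteredPair hp' hq'⟩

end IsPBWAlgebra
end TraceIdeal

/-! ### The algebra `A^τ` as a PBW algebra -/

section Concrete

variable {G : Subgroup (Matrix.SpecialLinearGroup (Fin 2) ℂ)}

/-- The matrix by which `g` acts on the coordinate functions. -/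
def coordMat (g : G) : Matrix (Fin 2) (Fin 2) ℂ[X] :=
  ((g⁻¹ : G) : Matrix.SpecialLinearGroup (Fin 2) ℂ).1.map Polynomial.C

lemma coordMat_mul (g h : G) : coordMat (g * h) = coordMat h * coordMat g := by
  rw [coordMat, coordMat, coordMat, mul_inv_rev, Subgroup.coe_mul,
    Matrix.SpecialLinearGroup.coe_mul, Matrix.map_mul]

lemma coordMat_one : coordMat (1 : G) = 1 := by
  rw [coordMat, inv_one, Subgroup.coe_one, Matrix.SpecialLinearGroup.coe_one,
    Matrix.map_one _ C_0 C_1]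

lemma coordMat_det (g : G) : (coordMat g).det = 1 := by
  have h : coordMat g =
      Polynomial.C.mapMatrix ((g⁻¹ : G) : Matrix.SpecialLinearGroup (Fin 2) ℂ).1 := rfl
  rw [h, ← RingHom.map_det, Matrix.SpecialLinearGroup.det_coe, map_one]

lemma smul_ι (g : G) (i : Fin 2) :
    g • (FreeAlgebra.ι ℂ[X] i : FreeXY) = ∑ j, coordMat g i j • FreeAlgebra.ι ℂ[X] j :=
  substHom_ι g i

/-- Compare the coefficients of `g h g` in `g τ = τ g`. -/
lemma coeff_mul_comm {τ : MonoidAlgebra ℂ[X] G}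
    (hτ : τ ∈ Subring.center (MonoidAlgebra ℂ[X] G)) (g h : G) :
    τ.coeff (g * h) = τ.coeff (h * g) := by
  have h1 := Subring.mem_center_iff.1 hτ (MonoidAlgebra.single g 1)
  have h2 := congrArg (fun s : MonoidAlgebra ℂ[X] G => s.coeff (g * h * g)) h1
  simp only [MonoidAlgebra.coeff_single_mul_apply, MonoidAlgebra.coeff_mul_single_apply] at h2
  simpa [mul_assoc] using h2.symm

variable [Fintype G] (τ : MonoidAlgebra ℂ[X] G)

/-- `ℂ[u]⟨x, y⟩` acting on the module of ordered monomials. -/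
def freeRep : FreeXY →ₐ[ℂ[X]] Module.End ℂ[X] (PBWModule ℂ[X] G) :=
  FreeAlgebra.lift ℂ[X] ![pbwX ℂ[X] G, pbwY coordMat fun g => τ.coeff g]

lemma freeRep_zero : freeRep τ (FreeAlgebra.ι ℂ[X] 0) = pbwX ℂ[X] G := by
  rw [freeRep, FreeAlgebra.lift_ι_apply]; rfl

lemma freeRep_one :
    freeRep τ (FreeAlgebra.ι ℂ[X] 1) = pbwY coordMat fun g => τ.coeff g := by
  rw [freeRep, FreeAlgebra.lift_ι_apply]; rfl

variable {τ} (hτ : τ ∈ Subring.center (MonoidAlgebra ℂ[X] G))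

/-- The group `G` acting on the module of ordered monomials. -/
def groupRep : G →* Module.End ℂ[X] (PBWModule ℂ[X] G) where
  toFun := pbwG coordMat fun g => τ.coeff g
  map_one' := pbwG_one _ _ coordMat_one
  map_mul' := pbwG_mul _ _ coordMat_mul coordMat_det (coeff_mul_comm hτ)

/-- This compatibility is what glues the two representations into one of the skew group algebra. -/
lemma freeRep_smul (g : G) (p : FreeXY) :
    freeRep τ (g • p) * groupRep hτ g = groupRep hτ g * freeRep τ p := by
  induction p using FreeAlgebra.induction with
  | grade0 r => rw [smul_algebraMap, AlgHom.commutes, Algebra.commutes]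
  | grade1 i =>
    rw [smul_ι, map_sum, Fin.sum_univ_two, map_smul, map_smul, freeRep_zero, freeRep_one]
    fin_cases i
    · exact ((pbwG_mul_pbwX coordMat (fun g => τ.coeff g) g).symm.trans
        (by rw [← freeRep_zero τ]; rfl))
    · exact ((pbwG_mul_pbwY coordMat (fun g => τ.coeff g) coordMat_mul coordMat_det
        (coeff_mul_comm hτ) g).symm.trans (by rw [← freeRep_one τ]; rfl))
  | mul a b ha hb => rw [smul_mul', map_mul, map_mul, mul_assoc, hb, ← mul_assoc, ha, mul_assoc]
  | add a b ha hb => rw [smul_add, map_add, map_add, add_mul, mul_add, ha, hb]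

/-- The skew group algebra acting on the module of ordered monomials. -/
def skewRep : SkewXY G →ₐ[ℂ[X]] Module.End ℂ[X] (PBWModule ℂ[X] G) :=
  SkewMonoidAlgebra.liftNCAlgHom (freeRep τ) (groupRep hτ)
    fun {p g} => freeRep_smul hτ g p

lemma skewRep_single (g : G) (p : FreeXY) :
    skewRep hτ (SkewMonoidAlgebra.single g p) = freeRep τ p * groupRep hτ g :=
  SkewMonoidAlgebra.liftNC_single _ _ _ _

lemma groupAlgebraIncl_eq_sum (s : MonoidAlgebra ℂ[X] G) :
    groupAlgebraIncl G s = ∑ g, s.coeff g • SkewMonoidAlgebra.of FreeXY G g := by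
  rw [groupAlgebraIncl, MonoidAlgebra.lift_apply, Finsupp.sum_fintype _ _ (by simp)]

lemma skewRep_of (g : G) : skewRep hτ (SkewMonoidAlgebra.of FreeXY G g) = groupRep hτ g := by
  rw [SkewMonoidAlgebra.of_apply, skewRep_single, map_one, one_mul]

/-- The algebra `A^τ` acting on the module of ordered monomials. -/
def algRep : AlgA τ →ₐ[ℂ[X]] Module.End ℂ[X] (PBWModule ℂ[X] G) :=
  RingQuot.liftAlgHom ℂ[X] ⟨skewRep hτ, by
    rintro _ _ ⟨rfl, rfl⟩
    rw [map_sub, map_zero, groupAlgebraIncl_eq_sum, map_sum, poly, skewRep_single, map_one,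
      mul_one, map_sub, map_mul, map_mul, freeRep_zero, freeRep_one, pbw_comm, sub_eq_zero]
    exact Finset.sum_congr rfl fun g _ => by rw [map_smul, skewRep_of]; rfl⟩

lemma algRep_mkA (s : SkewXY G) : algRep hτ (mkA τ s) = skewRep hτ s :=
  RingQuot.liftAlgHom_mkAlgHom_apply _ _ _ _

variable (τ) in
/-- The images of `x` and `y` in `A^τ`. -/
def varA (i : Fin 2) : AlgA τ := mkA τ (poly G (FreeAlgebra.ι ℂ[X] i))

variable (τ) in
/-- The homomorphism from `G` to `A^τ`. -/
def groupA : G →* AlgA τ := (mkA τ : SkewXY G →* AlgA τ).comp (SkewMonoidAlgebra.of FreeXY G)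

omit [Fintype G] in
lemma groupA_apply (g : G) : groupA τ g = mkA τ (SkewMonoidAlgebra.single g 1) := rfl

variable (G) in
omit [Fintype G] in
lemma poly_add (p q : FreeXY) : poly G (p + q) = poly G p + poly G q :=
  SkewMonoidAlgebra.single_add _ _ _

variable (G) in
omit [Fintype G] in
lemma poly_mul (p q : FreeXY) : poly G (p * q) = poly G p * poly G q := by
  rw [poly, poly, poly, SkewMonoidAlgebra.single_mul_single, one_smul, mul_one]

variable (G) in
omit [Fintype G] in
lemma poly_smul (r : ℂ[X]) (p : FreeXY) : poly G (r • p) = r • poly G p :=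
  (SkewMonoidAlgebra.smul_single _ _ _).symm

omit [Fintype G] in
lemma adjoin_varA_groupA :
    Algebra.adjoin ℂ[X] (Set.range (varA τ) ∪ Set.range (groupA τ)) = ⊤ := by
  set S := Algebra.adjoin ℂ[X] (Set.range (varA τ) ∪ Set.range (groupA τ))
  have hpoly : ∀ p, mkA τ (poly G p) ∈ S := by
    intro p
    induction p using FreeAlgebra.induction with
    | grade0 r =>
      have : poly G (algebraMap ℂ[X] FreeXY r) = algebraMap ℂ[X] (SkewXY G) r := by
        rw [Algebra.algebraMap_eq_smul_one, Algebra.algebraMap_eq_smul_one, poly_smul]; rfl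
      rw [this, AlgHom.commutes]
      exact S.algebraMap_mem r
    | grade1 i => exact Algebra.subset_adjoin (Or.inl ⟨i, rfl⟩)
    | mul a b ha hb => rw [poly_mul, map_mul]; exact S.mul_mem ha hb
    | add a b ha hb => rw [poly_add, map_add]; exact S.add_mem ha hb
  rw [eq_top_iff]
  rintro a -
  obtain ⟨s, rfl⟩ := RingQuot.mkAlgHom_surjective ℂ[X] (relA τ) a
  change mkA τ s ∈ S
  induction s using SkewMonoidAlgebra.induction_on with
  | zero => rw [map_zero]; exact S.zero_mem
  | single g p =>
    have : (SkewMonoidAlgebra.single g p : SkewXY G) =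
        poly G p * SkewMonoidAlgebra.single g 1 := by
      rw [poly, SkewMonoidAlgebra.single_mul_single, smul_one, mul_one, one_mul]
    rw [this, map_mul]
    exact S.mul_mem (hpoly p) (Algebra.subset_adjoin (Or.inr ⟨g, rfl⟩))
  | add s t hs ht => rw [map_add]; exact S.add_mem hs ht

lemma pbwX_pow_pbwY_pow (c : G → Matrix (Fin 2) (Fin 2) ℂ[X]) (t : G → ℂ[X]) (i j : ℕ) (g : G) :
    (pbwX ℂ[X] G ^ i) ((pbwY c t ^ j) (pbwVec ℂ[X] 0 0 g)) = pbwVec ℂ[X] i j g := by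
  have hY : (pbwY c t ^ j) (pbwVec ℂ[X] 0 0 g) = pbwVec ℂ[X] 0 j g := by
    induction j with
    | zero => simp
    | succ j ih => rw [pow_succ', Module.End.mul_apply, ih, pbwY_vec_zero]
  rw [hY]
  induction i with
  | zero => simp
  | succ i ih => rw [pow_succ', Module.End.mul_apply, ih, pbwX_vec]

-- The coordinate map is evaluation at the basis vector of `1` in the PBW representation: a monomial
-- applied to that vector returns its own symbol.
include hτ in
lemma isPBWAlgebra : IsPBWAlgebra coordMat (fun g => τ.coeff g) (varA τ) (groupA τ)
    ((LinearMap.applyₗ (pbwVec ℂ[X] 0 0 (1 : G))).comp (algRep hτ).toLinearMap) where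
  map_mul := coordMat_mul
  map_one := coordMat_one
  skew g i := by
    have h1 : (SkewMonoidAlgebra.single g 1 * poly G (FreeAlgebra.ι ℂ[X] i) : SkewXY G) =
        poly G (g • FreeAlgebra.ι ℂ[X] i) * SkewMonoidAlgebra.single g 1 := by
      rw [poly, poly, SkewMonoidAlgebra.single_mul_single, SkewMonoidAlgebra.single_mul_single,
        one_mul, one_mul, mul_one, smul_one, mul_one]
    rw [varA, groupA_apply, ← map_mul, h1, map_mul, smul_ι, Fin.sum_univ_two, Fin.sum_univ_two,
      poly_add, poly_smul, poly_smul, map_add, map_smul, map_smul]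
    rfl
  comm := by
    have h1 : mkA τ (poly G (FreeAlgebra.ι ℂ[X] 0 * FreeAlgebra.ι ℂ[X] 1
        - FreeAlgebra.ι ℂ[X] 1 * FreeAlgebra.ι ℂ[X] 0) - groupAlgebraIncl G τ) = mkA τ 0 :=
      RingQuot.mkAlgHom_rel ℂ[X] ⟨rfl, rfl⟩
    rw [map_zero, map_sub, sub_eq_zero, groupAlgebraIncl_eq_sum, map_sum] at h1
    have h2 : poly G (FreeAlgebra.ι ℂ[X] 0 * FreeAlgebra.ι ℂ[X] 1
        - FreeAlgebra.ι ℂ[X] 1 * FreeAlgebra.ι ℂ[X] 0) =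
        poly G (FreeAlgebra.ι ℂ[X] 0) * poly G (FreeAlgebra.ι ℂ[X] 1) -
          poly G (FreeAlgebra.ι ℂ[X] 1) * poly G (FreeAlgebra.ι ℂ[X] 0) := by
      rw [← poly_mul, ← poly_mul, eq_sub_iff_add_eq, ← poly_add, sub_add_cancel]
    rw [h2, map_sub, map_mul, map_mul] at h1
    refine h1.trans (Finset.sum_congr rfl fun g _ => ?_)
    rw [map_smul]; rfl
  adjoin := adjoin_varA_groupA
  coord i j g := by
    change algRep hτ _ (pbwVec ℂ[X] 0 0 (1 : G)) = _
    rw [map_mul, map_mul, map_pow, map_pow, varA, varA, groupA_apply, algRep_mkA, algRep_mkA,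
      algRep_mkA, poly, poly, skewRep_single, skewRep_single, skewRep_single, freeRep_zero,
      freeRep_one, map_one, map_one, mul_one, mul_one, one_mul]
    have h1 : groupRep hτ g (pbwVec ℂ[X] 0 0 (1 : G)) = pbwVec ℂ[X] 0 0 g := by
      change pbwG _ _ g _ = _
      rw [pbwG_vec, pow_zero, pow_zero, mul_one]; rfl
    rw [Module.End.mul_apply, h1, Module.End.mul_apply, pbwX_pow_pbwY_pow]

variable (τ) in
lemma sum_groupA_mem_traceIdeal : ∑ g, groupA τ g ∈ traceIdeal ℂ[X] (idemE τ) := by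
  have hc : (Fintype.card G : ℂ) ≠ 0 := Nat.cast_ne_zero.2 Fintype.card_ne_zero
  have h1 : ∑ g, groupA τ g = Polynomial.C (Fintype.card G : ℂ) • idemE τ := by
    rw [idemE, averaging, map_smul, smul_smul, ← Polynomial.C_mul, mul_inv_cancel₀ hc, C_1,
      one_smul, map_sum]
    refine Finset.sum_congr rfl fun g _ => ?_
    rw [groupAlgebraToA, AlgHom.comp_apply, groupAlgebraIncl, MonoidAlgebra.lift_of]
    rfl
  rw [h1]
  have := mul_mul_mem_traceIdeal (R := ℂ[X]) (e := idemE τ) 1 1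
  rw [one_mul, mul_one] at this
  exact Submodule.smul_mem _ _ this

/-- An element of finite order of `SL(2, ℂ)` with trace `2` is trivial. -/
lemma eq_one_of_trace_eq_two {g : Matrix.SpecialLinearGroup (Fin 2) ℂ} {m : ℕ} (hm : m ≠ 0)
    (hg : g ^ m = 1) (htr : g.1 0 0 + g.1 1 1 = 2) : g = 1 := by
  set n : Matrix (Fin 2) (Fin 2) ℂ := g.1 - 1 with hn
  have hdet := g.2
  rw [Matrix.det_fin_two] at hdet
  -- Cayley–Hamilton: trace two and determinant one give characteristic polynomial `(t - 1)²`.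
  have hnn : n * n = 0 := by
    have h11 : g.1 1 1 = 2 - g.1 0 0 := by linear_combination htr
    rw [h11] at hdet
    ext i j
    fin_cases i <;> fin_cases j <;>
      simp [hn, Matrix.mul_apply, Fin.sum_univ_two, h11] <;>
      first | ring1 | linear_combination -hdet
  have hpow : ∀ k : ℕ, g.1 ^ k = 1 + (k : ℂ) • n := by
    intro k
    induction k with
    | zero => simp
    | succ k ih =>
      have : g.1 = 1 + n := by rw [hn]; abel
      rw [pow_succ, ih, this, mul_add, mul_one, add_mul, one_mul, smul_mul_assoc, hnn, smul_zero]
      push_cast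
      module
  have h1 := hpow m
  rw [← Matrix.SpecialLinearGroup.coe_pow, hg, Matrix.SpecialLinearGroup.coe_one] at h1
  have h2 : (m : ℂ) • n = 0 := by simpa using h1.symm
  have h3 : n = 0 := (smul_eq_zero.1 h2).resolve_left (Nat.cast_ne_zero.2 hm)
  exact Subtype.ext (by rw [Matrix.SpecialLinearGroup.coe_one]; exact sub_eq_zero.1 h3)

/-- A nontrivial element of a finite subgroup of `SL(2, ℂ)` has no nonzero fixed vector. -/
lemma exists_sub_vecMul_eq (g : G) (hg : g ≠ 1) (a : Fin 2 → ℂ[X]) :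
    ∃ l, l - Matrix.vecMul l (coordMat g⁻¹) = a := by
  set M : Matrix (Fin 2) (Fin 2) ℂ := 1 - (g : Matrix.SpecialLinearGroup (Fin 2) ℂ).1 with hM
  have hdet : IsUnit M.det := by
    rw [isUnit_iff_ne_zero]
    -- For determinant one, `det (1 - g) = 2 - tr g`, so a singular `1 - g` would mean trace two.
    intro h0
    refine hg (Subtype.ext (eq_one_of_trace_eq_two (m := Fintype.card G) Fintype.card_ne_zero
      (by rw [← Subgroup.coe_pow, pow_card_eq_one]; rfl) ?_))
    have h1 := (g : Matrix.SpecialLinearGroup (Fin 2) ℂ).2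
    rw [Matrix.det_fin_two] at h0 h1
    simp [hM] at h0
    linear_combination h1 - h0
  refine ⟨Matrix.vecMul a (M⁻¹.map Polynomial.C), ?_⟩
  have h2 : (1 : Matrix (Fin 2) (Fin 2) ℂ[X]) - coordMat g⁻¹ = M.map Polynomial.C := by
    rw [coordMat, inv_inv, hM, Matrix.map_sub _ (fun a b => C_sub), Matrix.map_one _ C_0 C_1]
  nth_rw 1 [← Matrix.vecMul_one (Matrix.vecMul a (M⁻¹.map Polynomial.C))]
  rw [← Matrix.vecMul_sub, h2, Matrix.vecMul_vecMul, ← Matrix.map_mul,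
    Matrix.nonsing_inv_mul _ hdet, Matrix.map_one _ C_0 C_1, Matrix.vecMul_one]

end Concrete

end CBH

end

theorem mainTheorem9 (G : Subgroup (Matrix.SpecialLinearGroup (Fin 2) ℂ)) [Fintype G]
    (τ : MonoidAlgebra (Polynomial ℂ) G)
    (hτ : τ ∈ Subring.center (MonoidAlgebra (Polynomial ℂ) G)) :
    Module.Finite (CBH.AlgC τ)ᵐᵒᵖ (CBH.ModAe τ) ∧
    CBH.IsReflexiveRight (CBH.AlgC τ) (CBH.ModAe τ) ∧
    ∃ φ : CBH.AlgA τ ≃+* Module.End (CBH.AlgC τ)ᵐᵒᵖ (CBH.ModAe τ),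
      ∀ (a : CBH.AlgA τ) (m : CBH.ModAe τ),
        (φ a m : CBH.AlgA τ) = a * (m : CBH.AlgA τ) := by
  obtain ⟨p, hp, q, hq, N, h⟩ := (CBH.isPBWAlgebra hτ).exists_isFilteredPair
    (CBH.sum_groupA_mem_traceIdeal τ) CBH.exists_sub_vecMul_eq
  exact ⟨CBH.peirce_finite (CBH.idemE_idem τ) h hp hq,
    CBH.peirce_isReflexiveRight (CBH.idemE_idem τ) h hp hq,
    RingEquiv.ofBijective (CBH.mulLeftEnd (CBH.idemE_idem τ))
      (CBH.mulLeftEnd_bijective (CBH.idemE_idem τ) h hp hq),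
    fun a m => CBH.coe_mulLeftEnd (CBH.idemE_idem τ) a m⟩
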